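/- **Setting.** Let $m,n\ge 1$. The toroidal Aztec rectangle $T_{m,n}$ has as vertices the pairs $(i,j)\in \mathbb Z/2m\times\mathbb Z/2n$ (row, column) with $i+j$ odd, two vertices being adjacent iff both their rows and their columns differ by $\pm1$. (Equivalently, take the white squares of a $(2m+1)\times(2n+1)$ chessboard with black corners, join squares that share a corner, and identify the top and bottom rows and the left and right columns.) It is bipartite; fix a proper colouring of its vertices with the colours black and white. For $k,l\ge0$, the odd Aztec rectangle graph $O_{k,l}$ has as vertices the black squares of a $(2k+1)\times(2l+1)$ chessboard ($2k+1$ rows, $2l+1$ columns) with black corners, two squares being adjacent iff they share a corner. A window of shape $O_{k,l}$ in $T_{m,n}$ is the set of vertices covered by such a board laid (without rotation) on the torus so that its black squares are mapped injectively to vertices of $T_{m,n}$ and induce a copy of $O_{k,l}$; its center is the position of the central square of the board. A window is white-placed (black-placed) if the strict majority of its vertices is white (black). For a window $O$ of shape $O_{k,l}$, let $h(O)$ and $v(O)$ be the horizontal and the vertical diagonal slit of length $k+l+1$ with the same center as $O$; that is, the sets of vertices covered by the shapes $O_{0,k+l}$ and $O_{k+l,0}$ with that center. We say that a set $S$ of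 vertices crosses a set $S'$ if for some position $(i,j)$ the vertices $(i\pm1,j)$ belong to $S$ and the vertices $(i,j\pm1)$ belong to $S'$. Denote by $M(G)$ the number of perfect matchings of $G$. **Theorem.** Let $s,k,l\ge0$. Let $O_1,\dots,O_s$ be white-placed windows of shape $O_{k,l}$ and $O_{s+1},\dots,O_{2s}$ black-placed windows of shape $O_{l,k}$ in $T_{m,n}$, all mutually disjoint, such that $T_{m,n}\setminus(O_1\cup\cdots\cup O_{2s})$ has at least one perfect matching. In the degenerate case $l=0$, $s\ge2$ (when all windows are diagonal slits) assume also that no $O_i$ with $i\le s$ crosses an $O_j$ with $j>s$. Then $$M\bigl(T_{m,n}\setminus (O_1\cup\cdots\cup O_{2s})\bigr)=2^{-skl}\,M\bigl(T_{m,n}\setminus (h(O_1)\cup\cdots\cup h(O_s)\cup v(O_{s+1})\cup\cdots\cup v(O_{2s}))\bigr).$$ -/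

import Mathlib

/-! ## Toroidal Aztec rectangles

Rows are numbered downwards and columns rightwards. In `AR_{m,n}` (the white squares of a
`(2m+1) × (2n+1)` chessboard with black corners, joined when they share a corner) the square in row
`i` and column `j` is white iff `i + j` is odd. Gluing row `2m` to row `0` and column `2n` to
column `0` makes the row index live in `ZMod (2 * m)` and the column index in `ZMod (2 * n)`. -/

/-- Positions (squares of the glued chessboard, of either colour): (row, column). The positions
that are not vertices of `T_{m,n}` are the centres of its quadrangular faces. -/
abbrev TorusPos (m n : ℕ) : Type := ZMod (2 * m) × ZMod (2 * n)

/-- The vertices of `T_{m,n}`: the white squares of the glued chessboard. -/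
abbrev TorusVertex (m n : ℕ) : Type := {p : TorusPos m n // Odd (p.1.val + p.2.val)}

theorem zmod_two_mul_ne_add_one (m : ℕ) (a : ZMod (2 * m)) : a ≠ a + 1 := by
  intro h
  have h1 : (1 : ZMod (2 * m)) = 0 := by simpa using h.symm
  have h2 := congrArg (ZMod.castHom (Dvd.intro m rfl : 2 ∣ 2 * m) (ZMod 2)) h1
  rw [map_one, map_zero] at h2
  exact one_ne_zero h2

/-- The toroidal Aztec rectangle `T_{m,n}`: two vertices are adjacent iff the corresponding squares
share a corner, i.e. their rows differ by one and their columns differ by one (cyclically). -/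
def torusGraph (m n : ℕ) : SimpleGraph (TorusVertex m n) where
  Adj u v := (v.1.1 = u.1.1 + 1 ∨ u.1.1 = v.1.1 + 1) ∧ (v.1.2 = u.1.2 + 1 ∨ u.1.2 = v.1.2 + 1)
  symm := ⟨fun _ _ h => ⟨h.1.symm, h.2.symm⟩⟩
  loopless := ⟨fun u h => h.1.elim (zmod_two_mul_ne_add_one m u.1.1)
    (zmod_two_mul_ne_add_one m u.1.1)⟩

/-! ## Odd Aztec rectangles and windows -/

/-- The vertices of the odd Aztec rectangle graph `O_{k,l}`: the black squares of a
`(2k+1) × (2l+1)` chessboard with black corners. -/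
abbrev OddAztecVertex (k l : ℕ) : Type :=
  {p : Fin (2 * k + 1) × Fin (2 * l + 1) // Even (p.1.val + p.2.val)}

/-- The odd Aztec rectangle graph `O_{k,l}`: squares are adjacent iff they share a corner. -/
def oddAztecGraph (k l : ℕ) : SimpleGraph (OddAztecVertex k l) where
  Adj u v := (v.1.1.val = u.1.1.val + 1 ∨ u.1.1.val = v.1.1.val + 1) ∧
    (v.1.2.val = u.1.2.val + 1 ∨ u.1.2.val = v.1.2.val + 1)
  symm := ⟨fun _ _ h => ⟨h.1.symm, h.2.symm⟩⟩
  loopless := ⟨fun u h => by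
    have := h.1
    omega⟩

/-- The position taken by the square `p` of the `(2k+1) × (2l+1)` board when the board is laid
on the torus with its central square at the position `c`. -/
def boardPos {m n k l : ℕ} (c : TorusPos m n) (p : OddAztecVertex k l) : TorusPos m n :=
  (c.1 - (k : ZMod (2 * m)) + ((p.1.1.val : ℕ) : ZMod (2 * m)),
    c.2 - (l : ZMod (2 * n)) + ((p.1.2.val : ℕ) : ZMod (2 * n)))

/-- The set of vertices of `T_{m,n}` covered by the shape `O_{k,l}` laid with its centre at `c`. -/
def placedAztec (m n k l : ℕ) (c : TorusPos m n) : Set (TorusVertex m n) :=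
  {v | ∃ p : OddAztecVertex k l, v.1 = boardPos c p}

/-- An odd Aztec window of shape `O_{k,l}` in `T_{m,n}`: a placement of the shape, recorded by its
centre, for which the covered vertices form an induced copy of the graph `O_{k,l}`. -/
structure OddWindow (m n k l : ℕ) where
  center : TorusPos m n
  isCopy : ∃ φ : oddAztecGraph k l ↪g torusGraph m n, ∀ p, (φ p).1 = boardPos center p

namespace OddWindow

variable {m n k l : ℕ}

/-- The set of vertices removed by the window. -/
def verts (O : OddWindow m n k l) : Set (TorusVertex m n) := placedAztec m n k l O.center

/-- The horizontal diagonal slit of length `k + l + 1` with the same centre as the window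
(the shape `O_{0,k+l}`, a horizontal run of `k + l + 1` diagonally adjacent vertices). -/
def hSlit (O : OddWindow m n k l) : Set (TorusVertex m n) := placedAztec m n 0 (k + l) O.center

/-- The vertical diagonal slit of length `k + l + 1` with the same centre as the window
(the shape `O_{k+l,0}`). -/
def vSlit (O : OddWindow m n k l) : Set (TorusVertex m n) := placedAztec m n (k + l) 0 O.center

end OddWindow

/-- With respect to a proper 2-colouring (`true` is white, `false` is black), a set of vertices is
white-placed if the strict majority of its vertices is white. -/
def IsWhitePlaced {m n : ℕ} (c : (torusGraph m n).Coloring Bool)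
    (S : Set (TorusVertex m n)) : Prop :=
  {v ∈ S | c v = false}.ncard < {v ∈ S | c v = true}.ncard

/-- A set of vertices is black-placed if the strict majority of its vertices is black. -/
def IsBlackPlaced {m n : ℕ} (c : (torusGraph m n).Coloring Bool)
    (S : Set (TorusVertex m n)) : Prop :=
  {v ∈ S | c v = true}.ncard < {v ∈ S | c v = false}.ncard

/-- `S` crosses `S'`: some position `f` (the centre of a face of `T_{m,n}`) has the vertices
just above and below it in `S` and the vertices just left and right of it in `S'`. -/
def Crosses {m n : ℕ} (S S' : Set (TorusVertex m n)) : Prop :=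
  ∃ f : TorusPos m n,
    (∃ u ∈ S, u.1 = (f.1 - 1, f.2)) ∧ (∃ d ∈ S, d.1 = (f.1 + 1, f.2)) ∧
    (∃ a ∈ S', a.1 = (f.1, f.2 - 1)) ∧ (∃ b ∈ S', b.1 = (f.1, f.2 + 1))

/-! ## Counting perfect matchings -/

/-- The number of perfect matchings of the graph obtained from `T_{m,n}` by deleting the
vertices in `S`. -/
noncomputable def numMatchings (m n : ℕ) (S : Set (TorusVertex m n)) : ℕ :=
  {M : ((torusGraph m n).induce Sᶜ).Subgraph | M.IsPerfectMatching}.ncard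

/-! The proof is a complementation argument. The faces with both coordinates of a fixed parity `p`,
called cells, are four-cycles that partition the edges, and every vertex is shared by two of them.
Recording in which cell each vertex is matched turns the number of matchings into a sum, over
patterns, of products with one factor per cell (`Cells.card_configs`). Complementing the pattern in
every cell changes each factor only by a power of `√2` depending on the number of vertices covered
(`Cells.card_matchings_mul`), and a vertex matched in one of its two cells is again matched in
exactly one. Hence two graphs are comparable as soon as, at each vertex, their covering numbers add
up to the number of cells in use there (`Cells.card_configs_mul`).

Windows enter through unusable cells. Choose `p` so that the corners of a white window of shape
`O_{k+1,l}` are upper or lower vertices of cells. The window then contains both the upper and the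
lower vertex of `(k+1)(l+1)` cells, which become useless. The window `O_{k,l+1}` with the same
centre contains the left and right vertices of exactly these cells. Black windows behave in the same
way with rows and columns exchanged. Complementation outside the useless cells therefore trades
`O_{k+1,l}` for `O_{k,l+1}`; the vertex-by-vertex bookkeeping is `LocalWindows.count`. By
`Arrangement.numMatchings_compl` a step preserves the number of matchings times `2^(skl)`, where
`k`, `l` are the current parameters. Iterating until `k = 0` leaves the slits
(`Arrangement.numMatchings_slits`).

The existence of a matching forbids a surviving vertex between two useless cells, and this also
keeps the growing windows from wrapping around the torus. A crossing is a cell made useless by both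
colours. Disjointness excludes it when `l > 0`, so it matters only at the start with `l = 0`; there
it is excluded by assumption if `s ≥ 2`, and for `s = 1` a point reflection proves the claim
directly. -/

/-! ## Parity and arithmetic segments in `ZMod (2 * m)` -/

/-- The reduction of a row or column index modulo two. -/
def parity (m : ℕ) : ZMod (2 * m) →+* ZMod 2 := ZMod.castHom (Dvd.intro m rfl) (ZMod 2)

theorem odd_val_add_val_iff {m n : ℕ} (hm : 0 < m) (hn : 0 < n)
    (a : ZMod (2 * m)) (b : ZMod (2 * n)) :
    Odd (a.val + b.val) ↔ parity m a + parity n b = 1 := by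
  have : NeZero (2 * m) := ⟨by omega⟩
  have : NeZero (2 * n) := ⟨by omega⟩
  have ha : parity m a = (a.val : ZMod 2) := by
    conv_lhs => rw [← ZMod.natCast_zmod_val a]
    exact map_natCast _ _
  have hb : parity n b = (b.val : ZMod 2) := by
    conv_lhs => rw [← ZMod.natCast_zmod_val b]
    exact map_natCast _ _
  rw [ha, hb, ← Nat.cast_add, ZMod.natCast_eq_one_iff_odd]

/-- The `N` positions `c - (N - 1), c - (N - 3), …, c + (N - 1)`. -/
def arithSegment (m : ℕ) (c : ZMod (2 * m)) (N : ℕ) : Set (ZMod (2 * m)) :=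
  {a | ∃ x < N, a + (N : ZMod (2 * m)) = c + 2 * (x : ZMod (2 * m)) + 1}

section Segment

variable {m N : ℕ} {a c : ZMod (2 * m)}

theorem two_mul_natCast_inj {x y : ℕ} (hx : x < m) (hy : y < m)
    (h : (2 * (x : ZMod (2 * m))) = 2 * (y : ZMod (2 * m))) : x = y := by
  have h' : ((2 * x : ℕ) : ZMod (2 * m)) = ((2 * y : ℕ) : ZMod (2 * m)) := by
    push_cast; exact h
  rw [ZMod.natCast_eq_natCast_iff', Nat.mod_eq_of_lt (by omega), Nat.mod_eq_of_lt (by omega)] at h'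
  omega

theorem parity_of_mem_segment (h : a ∈ arithSegment m c N) :
    parity m a = parity m c + N + 1 := by
  obtain ⟨x, -, hx⟩ := h
  have h2 : (2 : ZMod 2) = 0 := rfl
  have := congrArg (parity m) hx
  simp only [map_add, map_mul, map_natCast, map_ofNat, map_one, h2, zero_mul] at this
  have hN : (N : ZMod 2) + N = 0 := CharTwo.add_self_eq_zero _
  linear_combination this - hN

theorem add_one_mem_segment (h : a ∈ arithSegment m c N) : a + 1 ∈ arithSegment m c (N + 1) := by
  obtain ⟨x, hx, h⟩ := h
  refine ⟨x + 1, by omega, ?_⟩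
  push_cast
  linear_combination h

theorem sub_one_mem_segment (h : a ∈ arithSegment m c N) : a - 1 ∈ arithSegment m c (N + 1) := by
  obtain ⟨x, hx, h⟩ := h
  refine ⟨x, by omega, ?_⟩
  push_cast
  linear_combination h

theorem mem_segment_or_of_mem_succ (hN : 0 < N) (h : a ∈ arithSegment m c (N + 1)) :
    a - 1 ∈ arithSegment m c N ∨ a + 1 ∈ arithSegment m c N := by
  obtain ⟨x, hx, h⟩ := h
  push_cast at h
  rcases Nat.lt_or_ge x N with h1 | h1
  · exact Or.inr ⟨x, h1, by linear_combination h⟩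
  · refine Or.inl ⟨x - 1, by omega, ?_⟩
    have : (x : ZMod (2 * m)) = ((x - 1 : ℕ) : ZMod (2 * m)) + 1 := by
      rw [← Nat.cast_add_one]; congr 1; omega
    rw [this] at h
    linear_combination h

/-- The bound keeps the indices of both neighbours below `m`, so that they are determined by the
positions and must be consecutive. For `N + 1 = m` the longer segment is a full parity class and the
conclusion fails. -/
theorem mem_segment_of_sub_of_add (hN : N + 1 < m) (h₁ : a - 1 ∈ arithSegment m c (N + 1))
    (h₂ : a + 1 ∈ arithSegment m c (N + 1)) : a ∈ arithSegment m c N := by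
  obtain ⟨x, hx, h₁⟩ := h₁
  obtain ⟨y, hy, h₂⟩ := h₂
  have : x + 1 = y := by
    apply two_mul_natCast_inj (m := m) (by omega) (by omega)
    push_cast
    linear_combination h₂ - h₁
  refine ⟨x, by omega, ?_⟩
  push_cast at h₁ ⊢
  linear_combination h₁

theorem mem_segment_iff_sub_and_add (hN : N + 1 < m) :
    a ∈ arithSegment m c N ↔ a - 1 ∈ arithSegment m c (N + 1) ∧ a + 1 ∈ arithSegment m c (N + 1) :=
  ⟨fun h => ⟨sub_one_mem_segment h, add_one_mem_segment h⟩,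
    fun h => mem_segment_of_sub_of_add hN h.1 h.2⟩

theorem mem_segment_succ_iff (hN : 0 < N) :
    a ∈ arithSegment m c (N + 1) ↔ a - 1 ∈ arithSegment m c N ∨ a + 1 ∈ arithSegment m c N := by
  refine ⟨mem_segment_or_of_mem_succ hN, ?_⟩
  rintro (h | h)
  · simpa using add_one_mem_segment h
  · simpa using sub_one_mem_segment h

theorem ncard_segment (hN : N ≤ m) : (arithSegment m c N).ncard = N := by
  have : arithSegment m c N =
      (fun x : ℕ => c + 2 * (x : ZMod (2 * m)) + 1 - N) '' (Finset.range N) := by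
    ext a
    simp only [arithSegment, Set.mem_ofPred_eq, Set.mem_image, Finset.coe_range, Set.mem_Iio]
    constructor
    · rintro ⟨x, hx, h⟩
      exact ⟨x, hx, by linear_combination -h⟩
    · rintro ⟨x, hx, h⟩
      exact ⟨x, hx, by linear_combination -h⟩
  rw [this, Set.InjOn.ncard_image, Set.ncard_coe_finset, Finset.card_range]
  intro x hx y hy h
  simp only [Finset.coe_range, Set.mem_Iio] at hx hy
  exact two_mul_natCast_inj (m := m) (by omega) (by omega) (by linear_combination h)

/-- A segment filling the whole circle has a neighbouring position on both sides which does not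
belong to the next smaller segment. -/
theorem exists_sub_add_mem_not_mem (hm : 0 < m) (c : ZMod (2 * m)) :
    ∃ b, b - 1 ∈ arithSegment m c m ∧
      b + 1 ∈ arithSegment m c m ∧ b ∉ arithSegment m c (m - 1) := by
  have hz : (2 * m : ZMod (2 * m)) = 0 := by
    have := ZMod.natCast_self (2 * m)
    push_cast at this
    exact this
  obtain ⟨j, rfl⟩ : ∃ j, m = j + 1 := ⟨m - 1, by omega⟩
  -- The witness is the antipode `c + m`: its neighbours are the last and the first element of the
  -- full segment, which meet there around the circle.
  refine ⟨c + (j + 1 : ℕ), ⟨j, by omega, ?_⟩, ⟨0, by omega, ?_⟩, ?_⟩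
  · push_cast; ring
  · push_cast at hz ⊢; linear_combination hz
  · rintro ⟨x, hx, h⟩
    have hx' : x < j := by simpa using hx
    have := two_mul_natCast_inj (m := j + 1) (x := x) (y := j) (by omega) (by omega)
      (by simp only [Nat.add_sub_cancel] at h; push_cast at h ⊢; linear_combination -h)
    omega

end Segment

/-! ## Membership in a placed odd Aztec rectangle -/

/-- The black squares of the board form two interleaved grids: those with both coordinates even
contain the corners, those with both coordinates odd form the smaller inner grid. The later parity
arguments decide which grid a vertex can lie on. -/
theorem mem_placedAztec_iff {m n k l : ℕ} {c : TorusPos m n} {v : TorusVertex m n} :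
    v ∈ placedAztec m n k l c ↔
      (v.1.1 ∈ arithSegment m c.1 (k + 1) ∧ v.1.2 ∈ arithSegment n c.2 (l + 1)) ∨
      (v.1.1 ∈ arithSegment m c.1 k ∧ v.1.2 ∈ arithSegment n c.2 l) := by
  simp only [placedAztec, Set.mem_ofPred_eq, boardPos, Prod.ext_iff]
  constructor
  · rintro ⟨⟨⟨⟨x, hx⟩, ⟨y, hy⟩⟩, he⟩, h1, h2⟩
    simp only at he h1 h2
    rcases Nat.even_or_odd' x with ⟨x', rfl | rfl⟩
    · obtain ⟨y', rfl⟩ : ∃ y', y = 2 * y' := by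
        rcases Nat.even_or_odd' y with ⟨y', rfl | rfl⟩
        · exact ⟨y', rfl⟩
        · exfalso; rw [Nat.even_iff] at he; omega
      refine Or.inl ⟨⟨x', by omega, ?_⟩, ⟨y', by omega, ?_⟩⟩
      · rw [h1]; push_cast; ring
      · rw [h2]; push_cast; ring
    · obtain ⟨y', rfl⟩ : ∃ y', y = 2 * y' + 1 := by
        rcases Nat.even_or_odd' y with ⟨y', rfl | rfl⟩
        · exfalso; rw [Nat.even_iff] at he; omega
        · exact ⟨y', rfl⟩
      refine Or.inr ⟨⟨x', by omega, ?_⟩, ⟨y', by omega, ?_⟩⟩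
      · rw [h1]; push_cast; ring
      · rw [h2]; push_cast; ring
  · rintro (⟨⟨x, hx, h1⟩, ⟨y, hy, h2⟩⟩ | ⟨⟨x, hx, h1⟩, ⟨y, hy, h2⟩⟩)
    · refine ⟨⟨(⟨2 * x, by omega⟩, ⟨2 * y, by omega⟩), ?_⟩, ?_, ?_⟩
      · rw [Nat.even_iff]; simp only; omega
      · push_cast at h1 ⊢; linear_combination h1
      · push_cast at h2 ⊢; linear_combination h2
    · refine ⟨⟨(⟨2 * x + 1, by omega⟩, ⟨2 * y + 1, by omega⟩), ?_⟩, ?_, ?_⟩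
      · rw [Nat.even_iff]; simp only; omega
      · push_cast at h1 ⊢; linear_combination h1
      · push_cast at h2 ⊢; linear_combination h2

/-! ## Complementation for graphs made of four-cycles

The edges of the graph are grouped into cells, each a four-cycle. The edge `(a, b)` of a cell joins
its lower (`a = true`) or upper (`a = false`) vertex to its right (`b = true`) or left
(`b = false`) vertex. The lower vertex of the cell `q` is the upper vertex of `down q`, and the
right vertex of `q` is the left vertex of `right q`. -/

namespace Cells

/-- A set of edges of a cell. -/
abbrev EdgeState : Type := Bool → Bool → Bool

/-- The number of edges at the lower or upper vertex. -/
def coverV (x : EdgeState) (a : Bool) : ℕ := (x a true).toNat + (x a false).toNat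

/-- The number of edges at the right or left vertex. -/
def coverH (x : EdgeState) (b : Bool) : ℕ := (x true b).toNat + (x false b).toNat

/-- A set of vertices of a cell, given by the lower and upper vertices and the right and left
vertices contained in it. -/
abbrev Pattern : Type := (Bool → Bool) × (Bool → Bool)

/-- The edge sets of a cell that match up the vertices in the given set. -/
def matchings (y : Pattern) : Finset EdgeState :=
  {x | (∀ a, coverV x a = (y.1 a).toNat) ∧ ∀ b, coverH x b = (y.2 b).toNat}

/-- The number of vertices in a pattern. -/
def size (y : Pattern) : ℕ :=
  (y.1 true).toNat + (y.1 false).toNat + ((y.2 true).toNat + (y.2 false).toNat)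

/-- The complementary set of vertices of a cell. -/
def compl (y : Pattern) : Pattern := (fun a => !y.1 a, fun b => !y.2 b)

/-- The empty set of vertices of a cell. -/
def empty : Pattern := (fun _ => false, fun _ => false)

theorem compl_compl (y : Pattern) : compl (compl y) = y := by
  simp [compl]

theorem card_matchings_empty : (matchings empty).card = 1 := by decide

theorem card_matchings_aux : ∀ p q r t : Bool,
    let y : Pattern := (fun a => bif a then p else q, fun b => bif b then r else t)
    ((matchings y).card = 0 ∧ (matchings (compl y)).card = 0) ∨
      ∃ j < 3, size (compl y) = 2 * j ∧
        (matchings y).card * 2 ^ j = 2 * (matchings (compl y)).card := by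
  decide

/-- Using `√2` makes the factor multiplicative over vertices even for patterns of odd size, where
both counts vanish. The product over all cells then depends only on the total number of covered
vertices. -/
theorem card_matchings_mul (y : Pattern) :
    ((matchings y).card : ℝ) * √2 ^ size (compl y) = 2 * (matchings (compl y)).card := by
  have hy : y = (fun a => bif a then y.1 true else y.1 false,
      fun b => bif b then y.2 true else y.2 false) := by
    apply Prod.ext <;> funext a <;> cases a <;> rfl
  have := card_matchings_aux (y.1 true) (y.1 false) (y.2 true) (y.2 false)
  simp only at this
  rw [← hy] at this
  rcases this with ⟨h1, h2⟩ | ⟨j, -, h1, h2⟩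
  · simp [h1, h2]
  · rw [h1, pow_mul, Real.sq_sqrt (by norm_num)]
    exact_mod_cast h2

variable {C : Type*} [Fintype C] [DecidableEq C] (down right : C ≃ C)

/-- The edge sets covering the lower vertex of each cell `q` exactly `h.1 q` times and the right
vertex exactly `h.2 q` times. -/
def configs (h : (C → ℕ) × (C → ℕ)) : Finset (C → EdgeState) :=
  {e | ∀ q, coverV (e q) true + coverV (e (down q)) false = h.1 q ∧
    coverH (e q) true + coverH (e (right q)) false = h.2 q}

/-- The patterns of covered vertices of the cells that are compatible with the covering numbers
`h` and do not involve the cells in `D`. -/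
def patterns (D : Finset C) (h : (C → ℕ) × (C → ℕ)) : Finset (C → Pattern) :=
  {y | (∀ q, (((y q).1 true).toNat + ((y (down q)).1 false).toNat = h.1 q ∧
    ((y q).2 true).toNat + ((y (right q)).2 false).toNat = h.2 q)) ∧ ∀ q ∈ D, y q = empty}

variable {down right}

theorem mem_configs {h : (C → ℕ) × (C → ℕ)} {e : C → EdgeState} :
    e ∈ configs down right h ↔ ∀ q, coverV (e q) true + coverV (e (down q)) false = h.1 q ∧
      coverH (e q) true + coverH (e (right q)) false = h.2 q := by
  simp only [configs, Finset.mem_filter, Finset.mem_univ, true_and]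

theorem mem_patterns {D : Finset C} {h : (C → ℕ) × (C → ℕ)} {y : C → Pattern} :
    y ∈ patterns down right D h ↔
      (∀ q, (((y q).1 true).toNat + ((y (down q)).1 false).toNat = h.1 q ∧
        ((y q).2 true).toNat + ((y (right q)).2 false).toNat = h.2 q)) ∧ ∀ q ∈ D, y q = empty := by
  simp only [patterns, Finset.mem_filter, Finset.mem_univ, true_and]

theorem toNat_inj {a b : Bool} (h : a.toNat = b.toNat) : a = b := by
  revert h
  cases a <;> cases b <;> simp

theorem matchings_disjoint {x : EdgeState} {y y' : Pattern} (h : x ∈ matchings y)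
    (h' : x ∈ matchings y') : y = y' := by
  simp only [matchings, Finset.mem_filter, Finset.mem_univ, true_and] at h h'
  apply Prod.ext
  · funext a
    exact toNat_inj ((h.1 a).symm.trans (h'.1 a))
  · funext b
    exact toNat_inj ((h.2 b).symm.trans (h'.2 b))

theorem toNat_decide_eq {t : ℕ} (h : t ≤ 1) : (decide (t = 1)).toNat = t := by
  interval_cases t <;> rfl

/-- Edge sets are sorted by the vertices they cover in each cell. Once this pattern is fixed, the
choices in different cells are independent. The condition `hD` makes the pattern empty on `D`, where
no complement will be taken. -/
theorem card_configs {D : Finset C} {h : (C → ℕ) × (C → ℕ)}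
    (h₁ : ∀ q, h.1 q ≤ 1) (h₂ : ∀ q, h.2 q ≤ 1)
    (hD : ∀ e ∈ configs down right h, ∀ q ∈ D, ∀ a b, e q a b = false) :
    (configs down right h).card =
      ∑ y ∈ patterns down right D h, ∏ q, (matchings (y q)).card := by
  have hV : ∀ e ∈ configs down right h, ∀ q a, coverV (e q) a ≤ 1 := by
    intro e he q a
    rw [mem_configs] at he
    cases a
    · have := (he (down.symm q)).1
      rw [Equiv.apply_symm_apply] at this
      have := h₁ (down.symm q)
      omega
    · have := (he q).1
      have := h₁ q
      omega
  have hH : ∀ e ∈ configs down right h, ∀ q a, coverH (e q) a ≤ 1 := by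
    intro e he q a
    rw [mem_configs] at he
    cases a
    · have := (he (right.symm q)).2
      rw [Equiv.apply_symm_apply] at this
      have := h₂ (right.symm q)
      omega
    · have := (he q).2
      have := h₂ q
      omega
  let f : (C → EdgeState) → C → Pattern := fun e q =>
    (fun a => decide (coverV (e q) a = 1), fun b => decide (coverH (e q) b = 1))
  have hf : ∀ e ∈ configs down right h, f e ∈ patterns down right D h := by
    intro e he
    have he' := he
    rw [mem_configs] at he'
    rw [mem_patterns]
    simp only [f]
    refine ⟨fun q => ?_, fun q hq => ?_⟩
    · rw [toNat_decide_eq (hV e he _ _), toNat_decide_eq (hV e he _ _),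
        toNat_decide_eq (hH e he _ _), toNat_decide_eq (hH e he _ _)]
      exact he' q
    · have := hD e he q hq
      simp [coverV, coverH, this, empty]
  rw [Finset.card_eq_sum_card_fiberwise hf]
  refine Finset.sum_congr rfl fun y hy => ?_
  rw [← Fintype.card_piFinset]
  congr 1
  ext e
  simp only [Finset.mem_filter, Fintype.mem_piFinset]
  constructor
  · rintro ⟨he, rfl⟩ q
    simp only [matchings, Finset.mem_filter, Finset.mem_univ, true_and, f]
    exact ⟨fun a => (toNat_decide_eq (hV e he _ _)).symm,
      fun a => (toNat_decide_eq (hH e he _ _)).symm⟩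
  · intro he
    have he' := he
    simp only [matchings, Finset.mem_filter, Finset.mem_univ, true_and] at he'
    rw [mem_patterns] at hy
    have hc : e ∈ configs down right h := by
      rw [mem_configs]
      intro q
      rw [(he' q).1, (he' q).2, (he' (down q)).1, (he' (right q)).2]
      exact hy.1 q
    refine ⟨hc, ?_⟩
    funext q
    refine matchings_disjoint (x := e q) ?_ (he q)
    simp only [matchings, Finset.mem_filter, Finset.mem_univ, true_and, f]
    exact ⟨fun a => (toNat_decide_eq (hV e hc _ _)).symm,
      fun a => (toNat_decide_eq (hH e hc _ _)).symm⟩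

/-- The number of cells among `q` and `q'` outside `D`. -/
def free (D : Finset C) (q q' : C) : ℕ := (if q ∈ D then 0 else 1) + (if q' ∈ D then 0 else 1)

/-- Complementation of the covered vertices in every cell outside `D`. -/
def complOutside (D : Finset C) (y : C → Pattern) : C → Pattern :=
  fun q => if q ∈ D then empty else compl (y q)

/-- At a vertex, each cell outside `D` covers it either before or after complementation, never both.
The two covering numbers thus add up to the number of such cells. -/
theorem complOutside_mem {D : Finset C} {h h' : (C → ℕ) × (C → ℕ)}
    (hA : ∀ q, h.1 q + h'.1 q = free D q (down q))
    (hB : ∀ q, h.2 q + h'.2 q = free D q (right q)) {y : C → Pattern}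
    (hy : y ∈ patterns down right D h) : complOutside D y ∈ patterns down right D h' := by
  rw [mem_patterns] at hy ⊢
  obtain ⟨hy, hD⟩ := hy
  have key : ∀ q, (∀ a, ((complOutside D y q).1 a).toNat + ((y q).1 a).toNat =
      if q ∈ D then 0 else 1) ∧ (∀ a, ((complOutside D y q).2 a).toNat + ((y q).2 a).toNat =
      if q ∈ D then 0 else 1) := by
    intro q
    by_cases hq : q ∈ D
    · simp [complOutside, hq, hD q hq, empty]
    · simp only [complOutside, hq, if_false, compl]
      refine ⟨fun a => ?_, fun a => ?_⟩
      · cases (y q).1 a <;> rfl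
      · cases (y q).2 a <;> rfl
  refine ⟨fun q => ⟨?_, ?_⟩, fun q hq => by simp [complOutside, hq]⟩
  · have h1 := (key q).1 true
    have h2 := (key (down q)).1 false
    have h3 := (hy q).1
    have h4 := hA q
    unfold free at h4
    omega
  · have h1 := (key q).2 true
    have h2 := (key (right q)).2 false
    have h3 := (hy q).2
    have h4 := hB q
    unfold free at h4
    omega

theorem complOutside_complOutside {D : Finset C} {h : (C → ℕ) × (C → ℕ)} {y : C → Pattern}
    (hy : y ∈ patterns down right D h) : complOutside D (complOutside D y) = y := by
  rw [mem_patterns] at hy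
  funext q
  by_cases hq : q ∈ D
  · simp [complOutside, hq, hy.2 q hq]
  · simp [complOutside, hq, compl_compl]

/-- Each vertex is the lower or right vertex of one cell and the upper or left vertex of another, so
reindexing along `down` and `right` collects its two contributions. -/
theorem sum_size {D : Finset C} {h : (C → ℕ) × (C → ℕ)} {y : C → Pattern}
    (hy : y ∈ patterns down right D h) : ∑ q, size (y q) = ∑ q, (h.1 q + h.2 q) := by
  rw [mem_patterns] at hy
  simp only [size, Finset.sum_add_distrib]
  rw [← Equiv.sum_comp down (fun q => ((y q).1 false).toNat),
    ← Equiv.sum_comp right (fun q => ((y q).2 false).toNat)]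
  simp only [← Finset.sum_add_distrib]
  exact Finset.sum_congr rfl fun q _ => by rw [(hy.1 q).1, (hy.1 q).2]

/-- The complementation theorem: if `h` and `h'` add up to the numbers of cells outside `D` at each
vertex, the numbers of edge sets with covering numbers `h` and `h'` differ by a power of `√2`. -/
theorem card_configs_mul {D : Finset C} {h h' : (C → ℕ) × (C → ℕ)}
    (h₁ : ∀ q, h.1 q ≤ 1) (h₂ : ∀ q, h.2 q ≤ 1) (h₁' : ∀ q, h'.1 q ≤ 1) (h₂' : ∀ q, h'.2 q ≤ 1)
    (hD : ∀ e ∈ configs down right h, ∀ q ∈ D, ∀ a b, e q a b = false)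
    (hD' : ∀ e ∈ configs down right h', ∀ q ∈ D, ∀ a b, e q a b = false)
    (hA : ∀ q, h.1 q + h'.1 q = free D q (down q))
    (hB : ∀ q, h.2 q + h'.2 q = free D q (right q)) :
    ((configs down right h).card : ℝ) * √2 ^ (∑ q, (h'.1 q + h'.2 q)) * 2 ^ D.card =
      2 ^ Fintype.card C * (configs down right h').card := by
  rw [card_configs h₁ h₂ hD, card_configs h₁' h₂' hD']
  push_cast
  rw [Finset.sum_mul, Finset.sum_mul, Finset.mul_sum]
  have hA' : ∀ q, h'.1 q + h.1 q = free D q (down q) := fun q => by rw [add_comm, hA]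
  have hB' : ∀ q, h'.2 q + h.2 q = free D q (right q) := fun q => by rw [add_comm, hB]
  refine Finset.sum_nbij' (complOutside D) (complOutside D) (fun y hy => complOutside_mem hA hB hy)
    (fun y hy => complOutside_mem hA' hB' hy) (fun y hy => complOutside_complOutside hy)
    (fun y hy => complOutside_complOutside hy) ?_
  intro y hy
  rw [← sum_size (complOutside_mem hA hB hy), ← Finset.prod_pow_eq_pow_sum,
    ← Finset.prod_mul_distrib]
  have hy' := hy
  rw [mem_patterns] at hy'
  have hcard : (2 : ℝ) ^ D.card = ∏ q, (if q ∈ D then 2 else 1) := by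
    rw [Finset.prod_ite_mem, Finset.univ_inter, Finset.prod_const]
  have hcard' : (2 : ℝ) ^ Fintype.card C = ∏ _q : C, 2 := by
    rw [Finset.prod_const, Finset.card_univ]
  rw [hcard, hcard', ← Finset.prod_mul_distrib, ← Finset.prod_mul_distrib]
  refine Finset.prod_congr rfl fun q _ => ?_
  by_cases hq : q ∈ D
  · have : size empty = 0 := rfl
    simp [complOutside, hq, hy'.2 q hq, card_matchings_empty, this]
  · simp only [complOutside, hq, if_false, mul_one]
    exact card_matchings_mul (y q)

end Cells

/-! ## The cells of the toroidal Aztec rectangle -/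

/-- The faces of the torus with both coordinates of parity `p`. Every edge belongs to exactly one
of them. -/
abbrev Cell (m n : ℕ) (p : ZMod 2) : Type :=
  {q : TorusPos m n // parity m q.1 = p ∧ parity n q.2 = p}

namespace Cell

open Cells

theorem two_eq_zero : (2 : ZMod 2) = 0 := rfl

theorem parity_two (m : ℕ) : parity m 2 = 0 := map_ofNat (parity m) 2

variable {m n : ℕ} {p : ZMod 2}

/-- The cell two rows below. -/
def down : Cell m n p ≃ Cell m n p where
  toFun q := ⟨(q.1.1 + 2, q.1.2), by simpa [parity_two] using q.2⟩
  invFun q := ⟨(q.1.1 - 2, q.1.2), by simpa [parity_two] using q.2⟩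
  left_inv q := by simp
  right_inv q := by simp

/-- The cell two columns to the right. -/
def right : Cell m n p ≃ Cell m n p where
  toFun q := ⟨(q.1.1, q.1.2 + 2), by simpa [parity_two] using q.2⟩
  invFun q := ⟨(q.1.1, q.1.2 - 2), by simpa [parity_two] using q.2⟩
  left_inv q := by simp
  right_inv q := by simp

/-! ### Matchings of the induced graph seen as relations on the torus. -/

section Lift

variable {S : Set (TorusVertex m n)}

/-- Adjacency in a subgraph of an induced subgraph, as a relation between vertices of the torus. -/
def liftAdj (M : ((torusGraph m n).induce Sᶜ).Subgraph) (u v : TorusVertex m n) : Prop :=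
  ∃ (hu : u ∈ Sᶜ) (hv : v ∈ Sᶜ), M.Adj ⟨u, hu⟩ ⟨v, hv⟩

theorem liftAdj_adj {M : ((torusGraph m n).induce Sᶜ).Subgraph} {u v : TorusVertex m n}
    (h : liftAdj M u v) : (torusGraph m n).Adj u v := by
  obtain ⟨hu, hv, h⟩ := h
  exact M.adj_sub h

theorem liftAdj_symm {M : ((torusGraph m n).induce Sᶜ).Subgraph} {u v : TorusVertex m n}
    (h : liftAdj M u v) : liftAdj M v u := by
  obtain ⟨hu, hv, h⟩ := h
  exact ⟨hv, hu, h.symm⟩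

theorem isPerfectMatching_iff_liftAdj (M : ((torusGraph m n).induce Sᶜ).Subgraph) :
    M.IsPerfectMatching ↔ ∀ u ∉ S, ∃! v, liftAdj M u v := by
  rw [SimpleGraph.Subgraph.isPerfectMatching_iff]
  constructor
  · intro h u hu
    obtain ⟨w, hw, hw'⟩ := h ⟨u, hu⟩
    refine ⟨w.1, ⟨hu, w.2, hw⟩, ?_⟩
    rintro v ⟨hu', hv, h'⟩
    exact congrArg Subtype.val (hw' ⟨v, hv⟩ h')
  · rintro h ⟨u, hu⟩
    obtain ⟨w, ⟨_, hw, hw1⟩, hw'⟩ := h u hu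
    exact ⟨⟨w, hw⟩, hw1, fun v hv => Subtype.ext (hw' v.1 ⟨hu, v.2, hv⟩)⟩

end Lift

variable [NeZero m] [NeZero n]

theorem odd_iff (a : ZMod (2 * m)) (b : ZMod (2 * n)) :
    Odd (a.val + b.val) ↔ parity m a + parity n b = 1 :=
  odd_val_add_val_iff (NeZero.pos m) (NeZero.pos n) a b

/-- The lower vertex of a cell. -/
def lower (q : Cell m n p) : TorusVertex m n :=
  ⟨(q.1.1 + 1, q.1.2), by
    rw [odd_iff, map_add, map_one, q.2.1, q.2.2]
    linear_combination CharTwo.add_self_eq_zero p⟩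

/-- The right vertex of a cell. -/
def rightmost (q : Cell m n p) : TorusVertex m n :=
  ⟨(q.1.1, q.1.2 + 1), by
    rw [odd_iff, map_add, map_one, q.2.1, q.2.2]
    linear_combination CharTwo.add_self_eq_zero p⟩

/-- The lower or the upper vertex of a cell. -/
def vertV (q : Cell m n p) (a : Bool) : TorusVertex m n :=
  bif a then lower q else lower (down.symm q)

/-- The right or the left vertex of a cell. -/
def vertH (q : Cell m n p) (b : Bool) : TorusVertex m n :=
  bif b then rightmost q else rightmost (right.symm q)

theorem vertV_true (q : Cell m n p) : (vertV q true).1 = (q.1.1 + 1, q.1.2) := rfl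

theorem vertV_false (q : Cell m n p) : (vertV q false).1 = (q.1.1 - 1, q.1.2) := by
  simp only [vertV, down, lower, cond_false, Equiv.coe_fn_symm_mk]
  congr 1
  ring

theorem vertH_true (q : Cell m n p) : (vertH q true).1 = (q.1.1, q.1.2 + 1) := rfl

theorem vertH_false (q : Cell m n p) : (vertH q false).1 = (q.1.1, q.1.2 - 1) := by
  simp only [vertH, right, rightmost, cond_false, Equiv.coe_fn_symm_mk]
  congr 1
  ring

theorem vertV_snd (q : Cell m n p) (a : Bool) : (vertV q a).1.2 = q.1.2 := by
  cases a
  · rw [vertV_false]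
  · rw [vertV_true]

theorem vertH_fst (q : Cell m n p) (a : Bool) : (vertH q a).1.1 = q.1.1 := by
  cases a
  · rw [vertH_false]
  · rw [vertH_true]

theorem vertV_down_false (q : Cell m n p) : vertV (down q) false = vertV q true := by
  simp [vertV]

theorem vertH_right_false (q : Cell m n p) : vertH (right q) false = vertH q true := by
  simp [vertH]

theorem adj_vertV_vertH (q : Cell m n p) (a b : Bool) :
    (torusGraph m n).Adj (vertV q a) (vertH q b) := by
  refine ⟨?_, ?_⟩
  · rw [vertH_fst]
    cases a
    · rw [vertV_false]; left; ring
    · rw [vertV_true]; right; rfl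
  · rw [vertV_snd]
    cases b
    · rw [vertH_false]; right; ring
    · rw [vertH_true]; left; rfl

theorem parity_vertV (q : Cell m n p) (a : Bool) : parity m (vertV q a).1.1 = p + 1 := by
  cases a
  · rw [vertV_false, map_sub, map_one, q.2.1]
    linear_combination - two_eq_zero
  · rw [vertV_true, map_add, map_one, q.2.1]

theorem parity_vertH (q : Cell m n p) (b : Bool) : parity m (vertH q b).1.1 = p := by
  rw [vertH_fst, q.2.1]

theorem vertV_ne_vertH (q q' : Cell m n p) (a b : Bool) : vertV q a ≠ vertH q' b := by
  intro h
  have h1 := parity_vertV q a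
  rw [h, parity_vertH] at h1
  exact one_ne_zero (left_eq_add.mp h1)

theorem exists_of_parity (v : TorusVertex m n) (h : parity m v.1.1 = p + 1) :
    ∃ q : Cell m n p, v = vertV q true := by
  have hv := (odd_iff _ _).mp v.2
  refine ⟨⟨(v.1.1 - 1, v.1.2), ?_, ?_⟩, ?_⟩
  · rw [map_sub, map_one, h]; ring
  · rw [h] at hv; linear_combination hv - CharTwo.add_self_eq_zero p
  · apply Subtype.ext
    rw [vertV_true]
    ext <;> simp

theorem exists_of_parity' (v : TorusVertex m n) (h : parity m v.1.1 = p) :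
    ∃ q : Cell m n p, v = vertH q true := by
  have hv := (odd_iff _ _).mp v.2
  refine ⟨⟨(v.1.1, v.1.2 - 1), h, ?_⟩, ?_⟩
  · rw [h] at hv
    rw [map_sub, map_one]
    linear_combination hv - CharTwo.add_self_eq_zero p
  · apply Subtype.ext
    rw [vertH_true]
    ext <;> simp

theorem parity_eq_or (p x : ZMod 2) : x = p + 1 ∨ x = p := by
  revert p x; decide

theorem exists_of_adj {u v : TorusVertex m n} (h : (torusGraph m n).Adj u v)
    (hu : parity m u.1.1 = p + 1) :
    ∃ (q : Cell m n p) (a b : Bool), u = vertV q a ∧ v = vertH q b := by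
  have hu' := (odd_iff _ _).mp u.2
  rw [hu] at hu'
  obtain ⟨⟨⟨u1, u2⟩, hu0⟩, ⟨⟨v1, v2⟩, hv0⟩⟩ := u, v
  simp only [torusGraph] at h hu hu'
  have hq : parity m v1 = p ∧ parity n u2 = p := by
    constructor
    · rcases h.1 with h | h
      · rw [h, map_add, map_one, hu]; linear_combination two_eq_zero
      · rw [h, map_add, map_one] at hu; exact add_right_cancel hu
    · linear_combination hu' - CharTwo.add_self_eq_zero p
  obtain ⟨h1, h2⟩ := h
  have ha : ∃ a, u1 = bif a then v1 + 1 else v1 - 1 := by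
    rcases h1 with h | h
    · exact ⟨false, by simp [h]⟩
    · exact ⟨true, h⟩
  have hb : ∃ b, v2 = bif b then u2 + 1 else u2 - 1 := by
    rcases h2 with h | h
    · exact ⟨true, h⟩
    · exact ⟨false, by simp [h]⟩
  obtain ⟨a, ha⟩ := ha
  obtain ⟨b, hb⟩ := hb
  -- The cell containing an edge has its row from the horizontal vertex `v` and its column from the
  -- vertical vertex `u`.
  refine ⟨⟨(v1, u2), hq⟩, a, b, Subtype.ext ?_, Subtype.ext ?_⟩
  · cases a
    · rw [vertV_false]; simp only [ha, cond_false]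
    · rw [vertV_true]; simp only [ha, cond_true]
  · cases b
    · rw [vertH_false]; simp only [hb, cond_false]
    · rw [vertH_true]; simp only [hb, cond_true]

theorem two_ne_zero_zmod {m : ℕ} (hm : 2 ≤ m) : (2 : ZMod (2 * m)) ≠ 0 := by
  intro h
  have : ((2 : ℕ) : ZMod (2 * m)) = 0 := by exact_mod_cast h
  rw [ZMod.natCast_eq_zero_iff] at this
  have := Nat.le_of_dvd (by norm_num) this
  omega

/-- With only two rows or columns the two opposite vertices of a cell would coincide; this is where
`m` and `n` must be at least two. -/
theorem edge_injective (hm : 2 ≤ m) (hn : 2 ≤ n) {q q' : Cell m n p} {a a' b b' : Bool}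
    (hV : vertV q a = vertV q' a') (hH : vertH q b = vertH q' b') : q = q' ∧ a = a' ∧ b = b' := by
  have h1 : q = q' := by
    apply Subtype.ext
    ext
    · rw [← vertH_fst q b, hH, vertH_fst]
    · rw [← vertV_snd q a, hV, vertV_snd]
  subst h1
  have h2 := two_ne_zero_zmod hm
  have h3 := two_ne_zero_zmod hn
  refine ⟨rfl, ?_, ?_⟩
  · have h := congrArg (fun v : TorusVertex m n => v.1.1) hV
    cases a <;> cases a' <;> simp only [vertV_true, vertV_false] at h ⊢
    · exact absurd (by linear_combination -h) h2
    · exact absurd (by linear_combination h) h2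
  · have h := congrArg (fun v : TorusVertex m n => v.1.2) hH
    cases b <;> cases b' <;> simp only [vertH_true, vertH_false] at h ⊢
    · exact absurd (by linear_combination -h) h3
    · exact absurd (by linear_combination h) h3

theorem existsUnique_bool_iff : ∀ r : Bool → Bool → Bool,
    (∃ x : Bool × Bool, r x.1 x.2 = true ∧ ∀ y : Bool × Bool, r y.1 y.2 = true → y = x) ↔
      (r true true).toNat + (r true false).toNat +
        ((r false true).toNat + (r false false).toNat) = 1 := by
  decide

open Classical in
theorem existsUnique_iff_sum {V : Type*} {R : V → Prop} (f : Bool → Bool → V)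
    (hf : ∀ a b a' b', f a b = f a' b' → a = a' ∧ b = b') (hR : ∀ w, R w → ∃ a b, w = f a b) :
    (∃! w, R w) ↔ (decide (R (f true true))).toNat + (decide (R (f true false))).toNat +
        ((decide (R (f false true))).toNat + (decide (R (f false false))).toNat) = 1 := by
  rw [← existsUnique_bool_iff fun a b => decide (R (f a b))]
  simp only [decide_eq_true_eq]
  constructor
  · rintro ⟨w, hw, hu⟩
    obtain ⟨a, b, rfl⟩ := hR w hw
    refine ⟨(a, b), hw, fun y hy => ?_⟩
    have := hf _ _ _ _ (hu _ hy)
    exact Prod.ext this.1 this.2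
  · rintro ⟨⟨a, b⟩, hx, hu⟩
    refine ⟨f a b, hx, fun w hw => ?_⟩
    obtain ⟨a', b', rfl⟩ := hR w hw
    have := hu (a', b') hw
    simp only [Prod.mk.injEq] at this
    rw [this.1, this.2]

/-! ### The correspondence between perfect matchings and edge sets of cells. -/

section Matchings

variable {S : Set (TorusVertex m n)}

open Classical in
/-- The edges of a subgraph, sorted by cells. -/
noncomputable def toConfig (p : ZMod 2) (M : ((torusGraph m n).induce Sᶜ).Subgraph) :
    Cell m n p → EdgeState :=
  fun q a b => decide (liftAdj M (vertV q a) (vertH q b))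

theorem existsUnique_vertV (hm : 2 ≤ m) (hn : 2 ≤ n)
    (M : ((torusGraph m n).induce Sᶜ).Subgraph) (q : Cell m n p) :
    (∃! v, liftAdj M (vertV q true) v) ↔
      coverV (toConfig p M q) true + coverV (toConfig p M (down q)) false = 1 := by
  classical
  -- The four edges at this vertex lie in two cells: it is the lower vertex of `q` (`a = true`) and
  -- the upper vertex of `down q` (`a = false`).
  rw [existsUnique_iff_sum (fun a b => vertH (bif a then q else down q) b)]
  · have h : ∀ b, toConfig p M (down q) false b =
        decide (liftAdj M (vertV q true) (vertH (down q) b)) := by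
      intro b
      rw [toConfig, decide_eq_decide, vertV_down_false]
    simp only [coverV, h]
    rfl
  · intro a b a' b' h
    have hV : vertV (bif a then q else down q) a = vertV (bif a' then q else down q) a' := by
      cases a <;> cases a' <;> simp [vertV_down_false]
    exact (edge_injective hm hn hV h).2
  · intro w hw
    obtain ⟨q', a, b, h1, h2⟩ := exists_of_adj (liftAdj_adj hw) (parity_vertV q true)
    refine ⟨a, b, ?_⟩
    rw [h2]
    congr 1
    cases a
    · apply (Equiv.symm_apply_eq down).mp
      rw [vertV, vertV, cond_true, cond_false] at h1
      have := congrArg Subtype.val h1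
      simp only [lower, Prod.mk.injEq] at this
      apply Subtype.ext
      ext
      · exact (add_right_cancel this.1).symm
      · exact this.2.symm
    · have := congrArg Subtype.val h1
      simp only [vertV_true, Prod.mk.injEq] at this
      apply Subtype.ext
      ext
      · exact (add_right_cancel this.1).symm
      · exact this.2.symm

theorem existsUnique_vertH (hm : 2 ≤ m) (hn : 2 ≤ n)
    (M : ((torusGraph m n).induce Sᶜ).Subgraph) (q : Cell m n p) :
    (∃! v, liftAdj M (vertH q true) v) ↔
      coverH (toConfig p M q) true + coverH (toConfig p M (right q)) false = 1 := by
  have hs : ∀ u v, liftAdj M u v ↔ liftAdj M v u := fun u v => ⟨liftAdj_symm, liftAdj_symm⟩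
  classical
  rw [existsUnique_iff_sum (fun b a => vertV (bif b then q else right q) a)]
  · have h : ∀ a, toConfig p M q a true = decide (liftAdj M (vertH q true) (vertV q a)) := by
      intro a
      rw [toConfig, decide_eq_decide, hs]
    have h' : ∀ a, toConfig p M (right q) a false =
        decide (liftAdj M (vertH q true) (vertV (right q) a)) := by
      intro a
      rw [toConfig, decide_eq_decide, hs, vertH_right_false]
    simp only [coverH, h, h', cond_true, cond_false]
  · intro b a b' a' h
    have hH : vertH (bif b then q else right q) b = vertH (bif b' then q else right q) b' := by
      cases b <;> cases b' <;> simp [vertH_right_false]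
    exact (edge_injective hm hn h hH).2.symm
  · intro w hw
    have hpw : parity m w.1.1 = p + 1 := by
      have := (liftAdj_adj hw).1
      have hq := parity_vertH q true
      rcases this with h | h
      · rw [h, map_add, hq, map_one]
      · rw [h, map_add, map_one] at hq
        linear_combination hq - two_eq_zero
    obtain ⟨q', a, b, h1, h2⟩ := exists_of_adj (liftAdj_adj (liftAdj_symm hw)) hpw
    refine ⟨b, a, ?_⟩
    rw [h1]
    congr 1
    cases b
    · apply (Equiv.symm_apply_eq right).mp
      rw [vertH, vertH, cond_true, cond_false] at h2
      have := congrArg Subtype.val h2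
      simp only [rightmost, Prod.mk.injEq] at this
      apply Subtype.ext
      ext
      · exact this.1.symm
      · exact (add_right_cancel this.2).symm
    · have := congrArg Subtype.val h2
      simp only [vertH_true, Prod.mk.injEq] at this
      apply Subtype.ext
      ext
      · exact this.1.symm
      · exact (add_right_cancel this.2).symm

open Classical in
/-- The covering numbers describing the vertices outside `S`: the lower vertices and the right
vertices of the cells. -/
noncomputable def present (p : ZMod 2) (S : Set (TorusVertex m n)) :
    (Cell m n p → ℕ) × (Cell m n p → ℕ) :=
  (fun q => if vertV q true ∈ S then 0 else 1, fun q => if vertH q true ∈ S then 0 else 1)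

theorem toConfig_eq_false_of_vertV {M : ((torusGraph m n).induce Sᶜ).Subgraph} {q : Cell m n p}
    {a : Bool} (h : vertV q a ∈ S) (b : Bool) : toConfig p M q a b = false := by
  simp only [toConfig, decide_eq_false_iff_not]
  rintro ⟨h', -⟩
  exact h' h

theorem toConfig_eq_false_of_vertH {M : ((torusGraph m n).induce Sᶜ).Subgraph} {q : Cell m n p}
    {b : Bool} (h : vertH q b ∈ S) (a : Bool) : toConfig p M q a b = false := by
  simp only [toConfig, decide_eq_false_iff_not]
  rintro ⟨-, h', -⟩
  exact h' h

theorem toConfig_mem (hm : 2 ≤ m) (hn : 2 ≤ n) {M : ((torusGraph m n).induce Sᶜ).Subgraph}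
    (hM : M.IsPerfectMatching) : toConfig p M ∈ configs down right (present p S) := by
  rw [isPerfectMatching_iff_liftAdj] at hM
  simp only [mem_configs, present]
  intro q
  constructor
  · split_ifs with h
    · have h' : vertV (down q) false ∈ S := by rwa [vertV_down_false]
      simp [coverV, toConfig_eq_false_of_vertV h, toConfig_eq_false_of_vertV h']
    · exact (existsUnique_vertV hm hn M q).mp (hM _ h)
  · split_ifs with h
    · have h' : vertH (right q) false ∈ S := by rwa [vertH_right_false]
      simp [coverH, toConfig_eq_false_of_vertH h, toConfig_eq_false_of_vertH h']
    · exact (existsUnique_vertH hm hn M q).mp (hM _ h)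

theorem not_mem_of_config {e : Cell m n p → EdgeState}
    (he : e ∈ configs down right (present p S)) {q : Cell m n p} {a b : Bool}
    (h : e q a b = true) : vertV q a ∉ S ∧ vertH q b ∉ S := by
  simp only [mem_configs, present] at he
  constructor
  · intro hS
    cases a
    · have h1 := (he (down.symm q)).1
      rw [← vertV_down_false, Equiv.apply_symm_apply, if_pos hS] at h1
      cases b <;> simp [coverV, h] at h1
    · have h1 := (he q).1
      rw [if_pos hS] at h1
      cases b <;> simp [coverV, h] at h1
  · intro hS
    cases b
    · have h1 := (he (right.symm q)).2
      rw [← vertH_right_false, Equiv.apply_symm_apply, if_pos hS] at h1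
      cases a <;> simp [coverH, h] at h1
    · have h1 := (he q).2
      rw [if_pos hS] at h1
      cases a <;> simp [coverH, h] at h1

/-- The spanning subgraph with the given edges. -/
def ofConfig (S : Set (TorusVertex m n)) (e : Cell m n p → EdgeState) :
    ((torusGraph m n).induce Sᶜ).Subgraph where
  verts := Set.univ
  Adj u v := ∃ q a b, e q a b = true ∧ ((u.1 = vertV q a ∧ v.1 = vertH q b) ∨
    (v.1 = vertV q a ∧ u.1 = vertH q b))
  adj_sub := by
    rintro u v ⟨q, a, b, -, ⟨hu, hv⟩ | ⟨hv, hu⟩⟩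
    · simp only [SimpleGraph.comap_adj, Function.Embedding.subtype_apply, hu, hv]
      exact adj_vertV_vertH q a b
    · simp only [SimpleGraph.comap_adj, Function.Embedding.subtype_apply, hu, hv]
      exact (adj_vertV_vertH q a b).symm
  edge_vert _ := Set.mem_univ _
  symm := ⟨by
    rintro u v ⟨q, a, b, h, h'⟩
    exact ⟨q, a, b, h, h'.symm⟩⟩

theorem toConfig_ofConfig (hm : 2 ≤ m) (hn : 2 ≤ n) {e : Cell m n p → EdgeState}
    (he : e ∈ configs down right (present p S)) : toConfig p (ofConfig S e) = e := by
  funext q a b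
  rw [Bool.eq_iff_iff]
  simp only [toConfig, decide_eq_true_eq]
  constructor
  · rintro ⟨_, _, q', a', b', h, ⟨h1, h2⟩ | ⟨h1, h2⟩⟩
    · obtain ⟨rfl, rfl, rfl⟩ := edge_injective hm hn h1 h2
      exact h
    · exact absurd h1.symm (vertV_ne_vertH _ _ _ _)
  · intro h
    obtain ⟨h1, h2⟩ := not_mem_of_config he h
    exact ⟨h1, h2, q, a, b, h, Or.inl ⟨rfl, rfl⟩⟩

theorem ofConfig_isPerfectMatching (hm : 2 ≤ m) (hn : 2 ≤ n) {e : Cell m n p → EdgeState}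
    (he : e ∈ configs down right (present p S)) : (ofConfig S e).IsPerfectMatching := by
  rw [isPerfectMatching_iff_liftAdj]
  intro u hu
  have he' := he
  simp only [mem_configs, present] at he'
  rcases parity_eq_or p (parity m u.1.1) with h | h
  · obtain ⟨q, rfl⟩ := exists_of_parity u h
    rw [existsUnique_vertV hm hn, toConfig_ofConfig hm hn he, (he' q).1, if_neg hu]
  · obtain ⟨q, rfl⟩ := exists_of_parity' u h
    rw [existsUnique_vertH hm hn, toConfig_ofConfig hm hn he, (he' q).2, if_neg hu]

theorem toConfig_le {M M' : ((torusGraph m n).induce Sᶜ).Subgraph}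
    (h : toConfig p M = toConfig p M') {u v : (Sᶜ : Set (TorusVertex m n))} (huv : M.Adj u v) :
    M'.Adj u v := by
  have key : ∀ (q : Cell m n p) (a b : Bool), liftAdj M (vertV q a) (vertH q b) →
      liftAdj M' (vertV q a) (vertH q b) := by
    intro q a b hM
    have := congrFun (congrFun (congrFun h q) a) b
    simp only [toConfig, decide_eq_decide] at this
    exact this.mp hM
  suffices liftAdj M' u.1 v.1 by
    obtain ⟨_, _, h⟩ := this
    exact h
  have hl : liftAdj M u.1 v.1 := ⟨u.2, v.2, huv⟩
  have ha : (torusGraph m n).Adj u.1 v.1 := liftAdj_adj hl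
  rcases parity_eq_or p (parity m u.1.1.1) with hp | hp
  · obtain ⟨q, a, b, h1, h2⟩ := exists_of_adj ha hp
    rw [h1, h2] at hl ⊢
    exact key q a b hl
  · have hp' : parity m v.1.1.1 = p + 1 := by
      rcases ha.1 with h | h
      · rw [h, map_add, map_one, hp]
      · rw [h, map_add, map_one] at hp
        linear_combination hp - two_eq_zero
    obtain ⟨q, a, b, h1, h2⟩ := exists_of_adj ha.symm hp'
    rw [h1, h2] at hl ⊢
    exact liftAdj_symm (key q a b (liftAdj_symm hl))

/-- Perfect matchings outside `S` correspond to edge sets with the covering numbers of `Sᶜ`. -/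
theorem numMatchings_eq (hm : 2 ≤ m) (hn : 2 ≤ n) (p : ZMod 2) (S : Set (TorusVertex m n)) :
    numMatchings m n S = (configs (C := Cell m n p) down right (present p S)).card := by
  rw [← Set.ncard_coe_finset, numMatchings]
  refine Set.ncard_congr (fun M _ => toConfig p M) (fun M hM => toConfig_mem hm hn hM) ?_ ?_
  · intro M M' hM hM' h
    refine SimpleGraph.Subgraph.ext ?_ ?_
    · rw [SimpleGraph.Subgraph.isSpanning_iff.mp hM.2, SimpleGraph.Subgraph.isSpanning_iff.mp hM'.2]
    · funext u v
      exact propext ⟨toConfig_le h, toConfig_le h.symm⟩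
  · intro e he
    exact ⟨ofConfig S e, ofConfig_isPerfectMatching hm hn he, toConfig_ofConfig hm hn he⟩

end Matchings

end Cell

/-! ## One complementation step -/

/-- The incidences of two families of windows with a vertex and its two cells. The vertex belongs
to the windows `X` and `Y`, and to the complementary windows `X'` and `Y'`; its cells are deleted
by `Xu`, `Yu` and by `Xd`, `Yd`. -/
structure LocalWindows {ι : Type*} (X Y X' Y' Xu Xd Yu Yd : ι → Prop) : Prop where
  mem_iff : ∀ i, X i ↔ Xu i ∨ Xd i
  mem_imp : ∀ i, Y i → Yu i ∧ Yd i
  mem_iff' : ∀ i, X' i ↔ Xu i ∧ Xd i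
  mem_imp' : ∀ i, Y' i ↔ Yu i ∨ Yd i
  inj : ∀ i j, X i → X j → i = j
  inj_up : ∀ i j, Yu i → Yu j → i = j
  inj_down : ∀ i j, Yd i → Yd j → i = j
  not_both : ∀ i j, X i → ¬ Y j
  cross_up : ∀ i j, Xu i → ¬ Yu j
  cross_down : ∀ i j, Xd i → ¬ Yd j
  free : (∀ i, ¬ X i) → (∀ i, ¬ Y i) → (∃ i, Xu i ∨ Yu i) → ¬ ∃ i, Xd i ∨ Yd i

namespace LocalWindows

variable {ι : Type*} {X Y X' Y' Xu Xd Yu Yd : ι → Prop}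

/-- Two deleted cells force the vertex to be removed. It cannot lie in a window of the other kind,
which would delete one of the two cells as well, so it lies in a window deleting both, and that
window is `i` and `j`. -/
theorem eq_of_up_of_down (L : LocalWindows X Y X' Y' Xu Xd Yu Yd) {i j : ι} (hi : Yu i)
    (hj : Yd j) : i = j ∧ Y i := by
  have hX : ∀ a, ¬ X a := by
    intro a ha
    rcases (L.mem_iff a).mp ha with h | h
    · exact L.cross_up a i h hi
    · exact L.cross_down a j h hj
  obtain ⟨a, ha⟩ : ∃ a, Y a := by
    by_contra h
    push Not at h
    exact L.free hX h ⟨i, Or.inr hi⟩ ⟨j, Or.inr hj⟩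
  obtain ⟨h1, h2⟩ := L.mem_imp a ha
  have h3 := L.inj_up _ _ hi h1
  exact ⟨h3.trans (L.inj_down _ _ h2 hj), h3 ▸ ha⟩

theorem inj_compl (L : LocalWindows X Y X' Y' Xu Xd Yu Yd) (i j : ι) (hi : X' i) (hj : X' j) :
    i = j :=
  L.inj i j ((L.mem_iff i).mpr (Or.inl ((L.mem_iff' i).mp hi).1))
    ((L.mem_iff j).mpr (Or.inl ((L.mem_iff' j).mp hj).1))

theorem not_both_compl (L : LocalWindows X Y X' Y' Xu Xd Yu Yd) (i j : ι) (hi : X' i) :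
    ¬ Y' j := by
  intro hj
  obtain ⟨h1, h2⟩ := (L.mem_iff' i).mp hi
  rcases (L.mem_imp' j).mp hj with h | h
  · exact L.cross_up i j h1 h
  · exact L.cross_down i j h2 h

theorem inj_compl' (L : LocalWindows X Y X' Y' Xu Xd Yu Yd) (i j : ι) (hi : Y' i) (hj : Y' j) :
    i = j := by
  rcases (L.mem_imp' i).mp hi with h | h <;> rcases (L.mem_imp' j).mp hj with h' | h'
  · exact L.inj_up i j h h'
  · exact (L.eq_of_up_of_down h h').1
  · exact (L.eq_of_up_of_down h' h).1.symm
  · exact L.inj_down i j h h'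

/-- A removed vertex of this kind has at least one deleted cell. It is absent from the complementary
graph exactly when no free cell is left at it. -/
theorem up_iff_down_of_X (L : LocalWindows X Y X' Y' Xu Xd Yu Yd) {i : ι} (hi : X i) :
    ((∃ j, Xu j ∨ Yu j) ∧ ∃ j, Xd j ∨ Yd j) ↔ (∃ j, X' j) ∨ ∃ j, Y' j := by
  have hXu : ∀ {j}, Xu j → X j := fun h => (L.mem_iff _).mpr (Or.inl h)
  have hXd : ∀ {j}, Xd j → X j := fun h => (L.mem_iff _).mpr (Or.inr h)
  constructor
  · rintro ⟨⟨a, ha | ha⟩, ⟨b, hb | hb⟩⟩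
    · obtain rfl := L.inj a b (hXu ha) (hXd hb)
      exact Or.inl ⟨a, (L.mem_iff' a).mpr ⟨ha, hb⟩⟩
    · exact Or.inr ⟨b, (L.mem_imp' b).mpr (Or.inr hb)⟩
    · exact Or.inr ⟨a, (L.mem_imp' a).mpr (Or.inl ha)⟩
    · exact Or.inr ⟨a, (L.mem_imp' a).mpr (Or.inl ha)⟩
  · rintro (⟨j, hj⟩ | ⟨j, hj⟩)
    · obtain ⟨h1, h2⟩ := (L.mem_iff' j).mp hj
      exact ⟨⟨j, Or.inl h1⟩, ⟨j, Or.inl h2⟩⟩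
    · rcases (L.mem_imp' j).mp hj with h | h
      · refine ⟨⟨j, Or.inr h⟩, i, ?_⟩
        rcases (L.mem_iff i).mp hi with h' | h'
        · exact absurd h (L.cross_up i j h')
        · exact Or.inl h'
      · refine ⟨⟨i, ?_⟩, j, Or.inr h⟩
        rcases (L.mem_iff i).mp hi with h' | h'
        · exact Or.inl h'
        · exact absurd h (L.cross_down i j h')

-- This is the local hypothesis of the complementation theorem: the number of the two graphs
-- containing the vertex equals the number of its cells that are not deleted.
open Classical in
theorem count (L : LocalWindows X Y X' Y' Xu Xd Yu Yd) :
    (if (∃ i, X i) ∨ ∃ i, Y i then 0 else 1) + (if (∃ i, X' i) ∨ ∃ i, Y' i then 0 else 1) =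
      (if ∃ i, Xu i ∨ Yu i then 0 else 1) + (if ∃ i, Xd i ∨ Yd i then 0 else 1) := by
  by_cases hX : ∃ i, X i
  · obtain ⟨i, hi⟩ := hX
    have key := L.up_iff_down_of_X hi
    have hor : (∃ j, Xu j ∨ Yu j) ∨ ∃ j, Xd j ∨ Yd j := by
      rcases (L.mem_iff i).mp hi with h | h
      · exact Or.inl ⟨i, Or.inl h⟩
      · exact Or.inr ⟨i, Or.inl h⟩
    rw [if_pos (Or.inl ⟨i, hi⟩)]
    simp only [← key]
    rcases hor with h | h
    · by_cases h' : ∃ j, Xd j ∨ Yd j <;> simp only [h, h', and_true, and_false, if_true, if_false]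
    · by_cases h' : ∃ j, Xu j ∨ Yu j <;>
        simp only [h, h', and_true, if_true, if_false]
  · by_cases hY : ∃ i, Y i
    · obtain ⟨i, hi⟩ := hY
      obtain ⟨h1, h2⟩ := L.mem_imp i hi
      rw [if_pos (Or.inr ⟨i, hi⟩), if_pos (Or.inr ⟨i, (L.mem_imp' i).mpr (Or.inl h1)⟩),
        if_pos ⟨i, Or.inr h1⟩, if_pos ⟨i, Or.inr h2⟩]
    · have hf := L.free (not_exists.mp hX) (not_exists.mp hY)
      have hXu : ∀ j, ¬ Xu j := fun j h => hX ⟨j, (L.mem_iff j).mpr (Or.inl h)⟩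
      have hXd : ∀ j, ¬ Xd j := fun j h => hX ⟨j, (L.mem_iff j).mpr (Or.inr h)⟩
      have hX' : ¬ ∃ j, X' j := fun ⟨j, h⟩ => hXu j ((L.mem_iff' j).mp h).1
      simp only [hXu, hXd, false_or] at hf ⊢
      simp only [hX, hY, hX', false_or, if_false, L.mem_imp', exists_or]
      by_cases h1 : ∃ j, Yu j
      · have h2 := hf h1
        simp only [h1, h2, true_or, if_true, if_false]
      · by_cases h2 : ∃ j, Yd j
        · simp only [h1, h2, or_true, if_true, if_false]
        · simp only [h1, h2, or_false, if_false]

end LocalWindows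

/-! ### Cardinalities of unions and rectangles of cells. -/

section Counting

theorem card_exists {ι C : Type*} [Fintype ι] [Fintype C] {P : ι → C → Prop} {x : ℕ}
    (hinj : ∀ q i j, P i q → P j q → i = j) (hx : ∀ i, {q | P i q}.ncard = x) :
    {q | ∃ i, P i q}.ncard = Fintype.card ι * x := by
  classical
  have : {q | ∃ i, P i q} = ⋃ i, {q | P i q} := by ext q; simp
  rw [this, Set.ncard_iUnion_of_finite (fun i => Set.toFinite _)]
  · simp [hx, finsum_eq_sum_of_fintype]
  · intro i j hij
    rw [Function.onFun, Set.disjoint_left]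
    intro q hi hj
    exact hij (hinj q i j hi hj)

theorem ncard_or {ι C : Type*} [Fintype ι] [Fintype C] {P Q : ι → C → Prop} {x y : ℕ}
    (hP : ∀ q i j, P i q → P j q → i = j) (hQ : ∀ q i j, Q i q → Q j q → i = j)
    (hPQ : ∀ q i j, P i q → ¬ Q j q)
    (hx : ∀ i, {q | P i q}.ncard = x) (hy : ∀ i, {q | Q i q}.ncard = y) :
    {q | (∃ i, P i q) ∨ ∃ i, Q i q}.ncard = Fintype.card ι * (x + y) := by
  have : {q | (∃ i, P i q) ∨ ∃ i, Q i q} = {q | ∃ i, P i q} ∪ {q | ∃ i, Q i q} := rfl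
  rw [this, Set.ncard_union_eq, card_exists hP hx, card_exists hQ hy, mul_add]
  rw [Set.disjoint_left]
  rintro q ⟨i, hi⟩ ⟨j, hj⟩
  exact hPQ q i j hi hj

/-- The shifts `a` and `b` lead from a cell to itself or to one of its vertices. The parity
conditions ensure that every point of the product of the two segments is reached from a cell. -/
theorem Cell.ncard_rectangle {m n : ℕ} [NeZero m] [NeZero n] {p : ZMod 2} {c : TorusPos m n}
    {N M : ℕ} (hN : N ≤ m) (hM : M ≤ n) (a : ZMod (2 * m)) (b : ZMod (2 * n))
    (ha : parity m c.1 + N + 1 = p + parity m a) (hb : parity n c.2 + M + 1 = p + parity n b) :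
    {q : Cell m n p | q.1.1 + a ∈ arithSegment m c.1 N ∧
      q.1.2 + b ∈ arithSegment n c.2 M}.ncard = N * M := by
  have hNM : N * M = (arithSegment m c.1 N ×ˢ arithSegment n c.2 M).ncard := by
    rw [Set.ncard_prod, ncard_segment hN, ncard_segment hM]
  rw [hNM]
  refine Set.ncard_congr (fun q _ => (q.1.1 + a, q.1.2 + b)) (fun q hq => hq) ?_ ?_
  · intro q q' _ _ h
    simp only [Prod.mk.injEq, add_left_inj] at h
    exact Subtype.ext (Prod.ext h.1 h.2)
  · rintro ⟨r, t⟩ ⟨hr, ht⟩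
    refine ⟨⟨(r - a, t - b), ?_, ?_⟩, ⟨?_, ?_⟩, ?_⟩
    · rw [map_sub, parity_of_mem_segment hr, ha]; ring
    · rw [map_sub, parity_of_mem_segment ht, hb]; ring
    · simpa using hr
    · simpa using ht
    · simp

end Counting

/-- In a placed rectangle, vertices in rows of the same parity as the corners. -/
theorem mem_placedAztec_iff_corner {m n k l : ℕ} {c : TorusPos m n} {v : TorusVertex m n}
    (h : parity m v.1.1 ≠ parity m c.1 + k + 1) :
    v ∈ placedAztec m n k l c ↔
      v.1.1 ∈ arithSegment m c.1 (k + 1) ∧ v.1.2 ∈ arithSegment n c.2 (l + 1) := by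
  rw [mem_placedAztec_iff]
  refine ⟨fun h' => h'.resolve_right fun h'' => h (parity_of_mem_segment h''.1), Or.inl⟩

/-- In a placed rectangle, vertices in rows of the parity opposite to that of the corners. -/
theorem mem_placedAztec_iff_inner {m n k l : ℕ} {c : TorusPos m n} {v : TorusVertex m n}
    (h : parity m v.1.1 ≠ parity m c.1 + k) :
    v ∈ placedAztec m n k l c ↔
      v.1.1 ∈ arithSegment m c.1 k ∧ v.1.2 ∈ arithSegment n c.2 l := by
  rw [mem_placedAztec_iff]
  refine ⟨fun h' => h'.resolve_left fun h'' => h ?_, Or.inr⟩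
  have := parity_of_mem_segment h''.1
  push_cast at this
  linear_combination this + CharTwo.add_self_eq_zero (1 : ZMod 2)

/-- Disjoint and non-crossing windows: the white-placed ones of shape `O_{k,l}` with centres `cW`
and corners in rows of parity `p + 1`, the black-placed ones of shape `O_{l,k}` with centres `cB`
and corners in rows of parity `p`. -/
structure Arrangement {m n s : ℕ} (k l : ℕ) (p : ZMod 2) (cW cB : Fin s → TorusPos m n) :
    Prop where
  parity_W : ∀ i, parity m (cW i).1 + k = p + 1 ∧ parity n (cW i).2 + l = p
  parity_B : ∀ i, parity m (cB i).1 + l = p ∧ parity n (cB i).2 + k = p + 1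
  bounds : k < m ∧ k < n ∧ l < m ∧ l < n
  disjoint_W : ∀ v i j, v ∈ placedAztec m n k l (cW i) → v ∈ placedAztec m n k l (cW j) → i = j
  disjoint_B : ∀ v i j, v ∈ placedAztec m n l k (cB i) → v ∈ placedAztec m n l k (cB j) → i = j
  disjoint_WB : ∀ v i j, v ∈ placedAztec m n k l (cW i) → v ∉ placedAztec m n l k (cB j)
  noncrossing : ∀ i j (f : TorusPos m n), f.1 ∈ arithSegment m (cW i).1 k →
    f.2 ∈ arithSegment n (cW i).2 (l + 1) → f.1 ∈ arithSegment m (cB j).1 (l + 1) →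
    f.2 ∉ arithSegment n (cB j).2 k

/-- The vertices removed by the windows of an arrangement. -/
def removedSet {m n s : ℕ} (k l : ℕ) (cW cB : Fin s → TorusPos m n) : Set (TorusVertex m n) :=
  (⋃ i, placedAztec m n k l (cW i)) ∪ ⋃ i, placedAztec m n l k (cB i)

theorem mem_removedSet {m n s k l : ℕ} {cW cB : Fin s → TorusPos m n} {v : TorusVertex m n} :
    v ∈ removedSet k l cW cB ↔
      (∃ i, v ∈ placedAztec m n k l (cW i)) ∨ ∃ i, v ∈ placedAztec m n l k (cB i) := by
  simp [removedSet]

/-- At a crossing, `l > 0` puts the vertex above or below `f` on the inner grid of the black window,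
while both these vertices are on the corner grid of the white one. The two windows would share a
vertex. -/
theorem noncrossing_of_disjoint {m n k l : ℕ} (hm : 0 < m) (hn : 0 < n) {p : ZMod 2}
    (hl : 0 < l) {cW cB : TorusPos m n} (hW : parity m cW.1 + k = p + 1 ∧ parity n cW.2 + l = p)
    (hd : ∀ v, v ∈ placedAztec m n k l cW → v ∉ placedAztec m n l k cB) (f : TorusPos m n)
    (h₁ : f.1 ∈ arithSegment m cW.1 k) (h₂ : f.2 ∈ arithSegment n cW.2 (l + 1))
    (h₃ : f.1 ∈ arithSegment m cB.1 (l + 1)) : f.2 ∉ arithSegment n cB.2 k := by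
  intro h₄
  have h0 : (1 : ZMod 2) + 1 = 0 := rfl
  have hp : parity m f.1 + parity n f.2 = 0 := by
    have h1 := parity_of_mem_segment h₁
    have h2 := parity_of_mem_segment h₂
    push_cast at h2
    rw [h1, h2]
    linear_combination hW.1 + hW.2 + CharTwo.add_self_eq_zero p + 2 * h0
  rcases mem_segment_or_of_mem_succ hl h₃ with h | h
  · refine hd ⟨(f.1 - 1, f.2), ?_⟩ ?_ ?_
    · rw [odd_val_add_val_iff hm hn, map_sub, map_one]
      linear_combination hp - h0
    · rw [mem_placedAztec_iff]
      exact Or.inl ⟨sub_one_mem_segment h₁, h₂⟩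
    · rw [mem_placedAztec_iff]
      exact Or.inr ⟨h, h₄⟩
  · refine hd ⟨(f.1 + 1, f.2), ?_⟩ ?_ ?_
    · rw [odd_val_add_val_iff hm hn, map_add, map_one]
      linear_combination hp
    · rw [mem_placedAztec_iff]
      exact Or.inl ⟨add_one_mem_segment h₁, h₂⟩
    · rw [mem_placedAztec_iff]
      exact Or.inr ⟨h, h₄⟩

namespace Arrangement

open Cells Cell

variable {m n s k l : ℕ} {p : ZMod 2} {cW cB : Fin s → TorusPos m n}

theorem one_add_one : (1 : ZMod 2) + 1 = 0 := rfl

/-- The window with centre `c` deletes the cell `q`, where `N` and `M` are the numbers of rows and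
columns of deleted cells. -/
def Deletes (N M : ℕ) (c : TorusPos m n) (q : Cell m n p) : Prop :=
  q.1.1 ∈ arithSegment m c.1 N ∧ q.1.2 ∈ arithSegment n c.2 M

theorem down_fst (q : Cell m n p) : (down q).1.1 = q.1.1 + 1 + 1 := by
  simp only [down, Equiv.coe_fn_mk]; ring

theorem down_snd (q : Cell m n p) : (down q).1.2 = q.1.2 := rfl

theorem right_fst (q : Cell m n p) : (right q).1.1 = q.1.1 := rfl

theorem right_snd (q : Cell m n p) : (right q).1.2 = q.1.2 + 1 + 1 := by
  simp only [right, Equiv.coe_fn_mk]; ring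

/-! ### Deleted cells in terms of segments. -/

section Faces

variable {N M : ℕ} {c : TorusPos m n} {q : Cell m n p}

theorem deletes_or_down (hN : 0 < N) : Deletes N M c q ∨ Deletes N M c (down q) ↔
    q.1.1 + 1 ∈ arithSegment m c.1 (N + 1) ∧ q.1.2 ∈ arithSegment n c.2 M := by
  rw [mem_segment_succ_iff hN, Deletes, Deletes, down_fst, down_snd, add_sub_cancel_right]
  tauto

theorem deletes_or_right (hM : 0 < M) : Deletes N M c q ∨ Deletes N M c (right q) ↔
    q.1.1 ∈ arithSegment m c.1 N ∧ q.1.2 + 1 ∈ arithSegment n c.2 (M + 1) := by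
  rw [mem_segment_succ_iff hM, Deletes, Deletes, right_fst, right_snd, add_sub_cancel_right]
  tauto

theorem deletes_and_down (h₁ : q.1.1 + 1 ∈ arithSegment m c.1 N)
    (h₂ : q.1.2 ∈ arithSegment n c.2 M) :
    Deletes (N + 1) M c q ∧ Deletes (N + 1) M c (down q) :=
  ⟨⟨by simpa using sub_one_mem_segment h₁, h₂⟩, ⟨down_fst q ▸ add_one_mem_segment h₁, h₂⟩⟩

theorem deletes_and_right (h₁ : q.1.1 ∈ arithSegment m c.1 N)
    (h₂ : q.1.2 + 1 ∈ arithSegment n c.2 M) :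
    Deletes N (M + 1) c q ∧ Deletes N (M + 1) c (right q) :=
  ⟨⟨h₁, by simpa using sub_one_mem_segment h₂⟩, ⟨h₁, right_snd q ▸ add_one_mem_segment h₂⟩⟩

theorem deletes_and_down_iff (hN : N + 1 < m) :
    q.1.1 + 1 ∈ arithSegment m c.1 N ∧ q.1.2 ∈ arithSegment n c.2 M ↔
      Deletes (N + 1) M c q ∧ Deletes (N + 1) M c (down q) := by
  rw [mem_segment_iff_sub_and_add hN, Deletes, Deletes, down_fst, down_snd, add_sub_cancel_right]
  tauto

theorem deletes_and_right_iff (hM : M + 1 < n) :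
    q.1.1 ∈ arithSegment m c.1 N ∧ q.1.2 + 1 ∈ arithSegment n c.2 M ↔
      Deletes N (M + 1) c q ∧ Deletes N (M + 1) c (right q) := by
  rw [mem_segment_iff_sub_and_add hM, Deletes, Deletes, right_fst, right_snd, add_sub_cancel_right]
  tauto

end Faces

theorem parity_W_compl (A : Arrangement (k + 1) l p cW cB) (i : Fin s) :
    parity m (cW i).1 + k = p := by
  have := (A.parity_W i).1
  push_cast at this
  exact add_right_cancel ((add_assoc _ _ _).trans this)

theorem parity_B_compl (A : Arrangement (k + 1) l p cW cB) (i : Fin s) :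
    parity m (cB i).1 + (l + 1 : ℕ) = p + 1 := by
  push_cast
  rw [← (A.parity_B i).1]
  ring

theorem not_deletes_both (A : Arrangement (k + 1) l p cW cB) (q : Cell m n p) {i j : Fin s}
    (hi : Deletes (k + 1) (l + 1) (cW i) q) :
    ¬ Deletes (l + 1) (k + 1) (cB j) q :=
  fun hj => A.noncrossing i j q.1 hi.1 hi.2 hj.1 hj.2

variable [NeZero m] [NeZero n]

/-! ### Which vertices of a cell lie in a window. -/

section Shape

variable {N M : ℕ} {c : TorusPos m n} {q : Cell m n p}

theorem lower_mem_iff_corner (h : parity m c.1 + N = p + 1) :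
    vertV q true ∈ placedAztec m n N M c ↔
      q.1.1 + 1 ∈ arithSegment m c.1 (N + 1) ∧ q.1.2 ∈ arithSegment n c.2 (M + 1) := by
  rw [mem_placedAztec_iff_corner, vertV_true]
  rw [parity_vertV, h]
  simp

theorem lower_mem_iff_inner (h : parity m c.1 + N = p) :
    vertV q true ∈ placedAztec m n N M c ↔
      q.1.1 + 1 ∈ arithSegment m c.1 N ∧ q.1.2 ∈ arithSegment n c.2 M := by
  rw [mem_placedAztec_iff_inner, vertV_true]
  rw [parity_vertV, h]
  simp

theorem right_mem_iff_corner (h : parity m c.1 + N = p) :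
    vertH q true ∈ placedAztec m n N M c ↔
      q.1.1 ∈ arithSegment m c.1 (N + 1) ∧ q.1.2 + 1 ∈ arithSegment n c.2 (M + 1) := by
  rw [mem_placedAztec_iff_corner, vertH_true]
  rw [parity_vertH, h]
  simp

theorem right_mem_iff_inner (h : parity m c.1 + N = p + 1) :
    vertH q true ∈ placedAztec m n N M c ↔
      q.1.1 ∈ arithSegment m c.1 N ∧ q.1.2 + 1 ∈ arithSegment n c.2 M := by
  rw [mem_placedAztec_iff_inner, vertH_true]
  rw [parity_vertH, h]
  simp

end Shape

section Vertices

variable (A : Arrangement (k + 1) l p cW cB) (i : Fin s) (q : Cell m n p)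
include A

theorem lower_mem_W : vertV q true ∈ placedAztec m n (k + 1) l (cW i) ↔
    Deletes (k + 1) (l + 1) (cW i) q ∨ Deletes (k + 1) (l + 1) (cW i) (down q) := by
  rw [lower_mem_iff_corner (A.parity_W i).1, deletes_or_down (Nat.succ_pos k)]

theorem lower_mem_B : vertV q true ∈ placedAztec m n l (k + 1) (cB i) ↔
    q.1.1 + 1 ∈ arithSegment m (cB i).1 l ∧ q.1.2 ∈ arithSegment n (cB i).2 (k + 1) :=
  lower_mem_iff_inner (A.parity_B i).1

theorem lower_mem_W_compl : vertV q true ∈ placedAztec m n k (l + 1) (cW i) ↔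
    q.1.1 + 1 ∈ arithSegment m (cW i).1 k ∧ q.1.2 ∈ arithSegment n (cW i).2 (l + 1) :=
  lower_mem_iff_inner (A.parity_W_compl i)

theorem lower_mem_B_compl : vertV q true ∈ placedAztec m n (l + 1) k (cB i) ↔
    q.1.1 + 1 ∈ arithSegment m (cB i).1 (l + 1 + 1) ∧
      q.1.2 ∈ arithSegment n (cB i).2 (k + 1) :=
  lower_mem_iff_corner (A.parity_B_compl i)

theorem right_mem_W : vertH q true ∈ placedAztec m n (k + 1) l (cW i) ↔
    q.1.1 ∈ arithSegment m (cW i).1 (k + 1) ∧ q.1.2 + 1 ∈ arithSegment n (cW i).2 l :=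
  right_mem_iff_inner (A.parity_W i).1

theorem right_mem_B : vertH q true ∈ placedAztec m n l (k + 1) (cB i) ↔
    Deletes (l + 1) (k + 1) (cB i) q ∨ Deletes (l + 1) (k + 1) (cB i) (right q) := by
  rw [right_mem_iff_corner (A.parity_B i).1, deletes_or_right (Nat.succ_pos k)]

theorem right_mem_W_compl : vertH q true ∈ placedAztec m n k (l + 1) (cW i) ↔
    q.1.1 ∈ arithSegment m (cW i).1 (k + 1) ∧
      q.1.2 + 1 ∈ arithSegment n (cW i).2 (l + 1 + 1) :=
  right_mem_iff_corner (A.parity_W_compl i)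

theorem right_mem_B_compl : vertH q true ∈ placedAztec m n (l + 1) k (cB i) ↔
    q.1.1 ∈ arithSegment m (cB i).1 (l + 1) ∧ q.1.2 + 1 ∈ arithSegment n (cB i).2 k :=
  right_mem_iff_inner (A.parity_B_compl i)

theorem deletes_inj_W {i j : Fin s} (hi : Deletes (k + 1) (l + 1) (cW i) q)
    (hj : Deletes (k + 1) (l + 1) (cW j) q) : i = j :=
  A.disjoint_W (vertV q true) i j ((A.lower_mem_W i q).mpr (Or.inl hi))
    ((A.lower_mem_W j q).mpr (Or.inl hj))

theorem deletes_inj_B {i j : Fin s} (hi : Deletes (l + 1) (k + 1) (cB i) q)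
    (hj : Deletes (l + 1) (k + 1) (cB j) q) : i = j :=
  A.disjoint_B (vertH q true) i j ((A.right_mem_B i q).mpr (Or.inl hi))
    ((A.right_mem_B j q).mpr (Or.inl hj))

theorem vertV_mem_of_deletes {q : Cell m n p} (h : Deletes (k + 1) (l + 1) (cW i) q) (a : Bool) :
    vertV q a ∈ removedSet (k + 1) l cW cB := by
  rw [mem_removedSet]
  refine Or.inl ⟨i, ?_⟩
  cases a
  · have : vertV q false = vertV (down.symm q) true := rfl
    rw [this, A.lower_mem_W, Equiv.apply_symm_apply]
    exact Or.inr h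
  · rw [A.lower_mem_W]
    exact Or.inl h

theorem vertH_mem_of_deletes {q : Cell m n p} (h : Deletes (l + 1) (k + 1) (cB i) q) (a : Bool) :
    vertH q a ∈ removedSet (k + 1) l cW cB := by
  rw [mem_removedSet]
  refine Or.inr ⟨i, ?_⟩
  cases a
  · have : vertH q false = vertH (right.symm q) true := rfl
    rw [this, A.right_mem_B, Equiv.apply_symm_apply]
    exact Or.inr h
  · rw [A.right_mem_B]
    exact Or.inl h

theorem vertH_mem_compl_of_deletes {q : Cell m n p} (h : Deletes (k + 1) (l + 1) (cW i) q)
    (a : Bool) : vertH q a ∈ removedSet k (l + 1) cW cB := by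
  rw [mem_removedSet]
  refine Or.inl ⟨i, ?_⟩
  cases a
  · have : vertH q false = vertH (right.symm q) true := rfl
    rw [this, A.right_mem_W_compl, ← deletes_or_right (Nat.succ_pos l), Equiv.apply_symm_apply]
    exact Or.inr h
  · rw [A.right_mem_W_compl, ← deletes_or_right (Nat.succ_pos l)]
    exact Or.inl h

theorem vertV_mem_compl_of_deletes {q : Cell m n p} (h : Deletes (l + 1) (k + 1) (cB i) q)
    (a : Bool) : vertV q a ∈ removedSet k (l + 1) cW cB := by
  rw [mem_removedSet]
  refine Or.inr ⟨i, ?_⟩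
  cases a
  · have : vertV q false = vertV (down.symm q) true := rfl
    rw [this, A.lower_mem_B_compl, ← deletes_or_down (Nat.succ_pos l), Equiv.apply_symm_apply]
    exact Or.inr h
  · rw [A.lower_mem_B_compl, ← deletes_or_down (Nat.succ_pos l)]
    exact Or.inl h

end Vertices

open Classical in
/-- The cells deleted by the windows of an arrangement. -/
noncomputable def deleted (k l : ℕ) (p : ZMod 2) (cW cB : Fin s → TorusPos m n) :
    Finset (Cell m n p) :=
  {q | ∃ i, Deletes (k + 1) (l + 1) (cW i) q ∨ Deletes (l + 1) (k + 1) (cB i) q}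

theorem mem_deleted {q : Cell m n p} : q ∈ deleted k l p cW cB ↔
    ∃ i, Deletes (k + 1) (l + 1) (cW i) q ∨ Deletes (l + 1) (k + 1) (cB i) q := by
  simp only [deleted, Finset.mem_filter, Finset.mem_univ, true_and]

/-- Each edge of a cell uses one vertical and one horizontal vertex. A deleted cell has lost both
vertical ones to a white window or both horizontal ones to a black window. -/
theorem config_deleted (A : Arrangement (k + 1) l p cW cB) {e : Cell m n p → EdgeState}
    (he : e ∈ configs down right (present p (removedSet (k + 1) l cW cB))) {q : Cell m n p}
    (hq : q ∈ deleted k l p cW cB) (a b : Bool) : e q a b = false := by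
  by_contra h
  rw [Bool.not_eq_false] at h
  obtain ⟨h1, h2⟩ := not_mem_of_config he h
  obtain ⟨i, hi | hi⟩ := mem_deleted.mp hq
  · exact h1 (A.vertV_mem_of_deletes i hi a)
  · exact h2 (A.vertH_mem_of_deletes i hi b)

theorem config_deleted_compl (A : Arrangement (k + 1) l p cW cB) {e : Cell m n p → EdgeState}
    (he : e ∈ configs down right (present p (removedSet k (l + 1) cW cB))) {q : Cell m n p}
    (hq : q ∈ deleted k l p cW cB) (a b : Bool) : e q a b = false := by
  by_contra h
  rw [Bool.not_eq_false] at h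
  obtain ⟨h1, h2⟩ := not_mem_of_config he h
  obtain ⟨i, hi | hi⟩ := mem_deleted.mp hq
  · exact h2 (A.vertH_mem_compl_of_deletes i hi b)
  · exact h1 (A.vertV_mem_compl_of_deletes i hi a)

theorem exists_config (hm : 2 ≤ m) (hn : 2 ≤ n) (p : ZMod 2) {S : Set (TorusVertex m n)}
    (hM : numMatchings m n S ≠ 0) :
    ∃ e : Cell m n p → EdgeState, e ∈ configs down right (present p S) := by
  rw [numMatchings_eq hm hn p] at hM
  exact Finset.card_ne_zero.mp hM

/-! ### The situation at a single vertex. -/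

section Local

variable (A : Arrangement (k + 1) l p cW cB) (hm : 2 ≤ m) (hn : 2 ≤ n)
  (hM : numMatchings m n (removedSet (k + 1) l cW cB) ≠ 0) (q : Cell m n p)
include A hm hn hM

/-- A surviving vertex whose two cells are both deleted has no available edge, contrary to the
existence of a matching. -/
theorem free_down (h : vertV q true ∉ removedSet (k + 1) l cW cB)
    (h' : q ∈ deleted k l p cW cB) : down q ∉ deleted k l p cW cB := by
  intro h''
  obtain ⟨e, he⟩ := exists_config hm hn p hM
  have h1 := (mem_configs.mp he q).1
  simp only [coverV, A.config_deleted he h', A.config_deleted he h'', present, if_neg h] at h1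
  simp at h1

theorem free_right (h : vertH q true ∉ removedSet (k + 1) l cW cB)
    (h' : q ∈ deleted k l p cW cB) : right q ∉ deleted k l p cW cB := by
  intro h''
  obtain ⟨e, he⟩ := exists_config hm hn p hM
  have h1 := (mem_configs.mp he q).2
  simp only [coverH, A.config_deleted he h', A.config_deleted he h'', present, if_neg h] at h1
  simp at h1

theorem local_lower : LocalWindows
    (fun i => vertV q true ∈ placedAztec m n (k + 1) l (cW i))
    (fun i => vertV q true ∈ placedAztec m n l (k + 1) (cB i))
    (fun i => vertV q true ∈ placedAztec m n k (l + 1) (cW i))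
    (fun i => vertV q true ∈ placedAztec m n (l + 1) k (cB i))
    (fun i => Deletes (k + 1) (l + 1) (cW i) q)
    (fun i => Deletes (k + 1) (l + 1) (cW i) (down q))
    (fun i => Deletes (l + 1) (k + 1) (cB i) q)
    (fun i => Deletes (l + 1) (k + 1) (cB i) (down q)) where
  mem_iff i := A.lower_mem_W i q
  -- Only an implication is available here: the converse would need `l + 1 < m`, which is itself
  -- deduced from these local data in `lt_left`. For the shrinking direction `k + 1 < m` is already
  -- known.
  mem_imp i h := deletes_and_down ((A.lower_mem_B i q).mp h).1 ((A.lower_mem_B i q).mp h).2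
  mem_iff' i := by rw [A.lower_mem_W_compl, deletes_and_down_iff A.bounds.1]
  mem_imp' i := by rw [A.lower_mem_B_compl, deletes_or_down (Nat.succ_pos l)]
  inj i j hi hj := A.disjoint_W _ i j hi hj
  inj_up _ _ hi hj := A.deletes_inj_B q hi hj
  inj_down _ _ hi hj := A.deletes_inj_B _ hi hj
  not_both i j hi := A.disjoint_WB _ i j hi
  cross_up _ _ hi := A.not_deletes_both q hi
  cross_down _ _ hi := A.not_deletes_both _ hi
  free h₁ h₂ h := by
    rw [← mem_deleted] at h ⊢
    refine A.free_down hm hn hM q ?_ h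
    rw [mem_removedSet]
    rintro (⟨i, hi⟩ | ⟨i, hi⟩)
    · exact h₁ i hi
    · exact h₂ i hi

/-- The two colours exchange roles, since right vertices lie in rows of parity `p`, the corner rows
of the black windows. -/
theorem local_right : LocalWindows
    (fun i => vertH q true ∈ placedAztec m n l (k + 1) (cB i))
    (fun i => vertH q true ∈ placedAztec m n (k + 1) l (cW i))
    (fun i => vertH q true ∈ placedAztec m n (l + 1) k (cB i))
    (fun i => vertH q true ∈ placedAztec m n k (l + 1) (cW i))
    (fun i => Deletes (l + 1) (k + 1) (cB i) q)
    (fun i => Deletes (l + 1) (k + 1) (cB i) (right q))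
    (fun i => Deletes (k + 1) (l + 1) (cW i) q)
    (fun i => Deletes (k + 1) (l + 1) (cW i) (right q)) where
  mem_iff i := A.right_mem_B i q
  mem_imp i h := deletes_and_right ((A.right_mem_W i q).mp h).1 ((A.right_mem_W i q).mp h).2
  mem_iff' i := by rw [A.right_mem_B_compl, deletes_and_right_iff A.bounds.2.1]
  mem_imp' i := by rw [A.right_mem_W_compl, deletes_or_right (Nat.succ_pos l)]
  inj i j hi hj := A.disjoint_B _ i j hi hj
  inj_up _ _ hi hj := A.deletes_inj_W q hi hj
  inj_down _ _ hi hj := A.deletes_inj_W _ hi hj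
  not_both i j hi hj := A.disjoint_WB _ j i hj hi
  cross_up _ _ hi hj := A.not_deletes_both q hj hi
  cross_down _ _ hi hj := A.not_deletes_both _ hj hi
  free h₁ h₂ h := by
    have hc : ∀ q : Cell m n p, (∃ i, Deletes (l + 1) (k + 1) (cB i) q ∨
        Deletes (k + 1) (l + 1) (cW i) q) ↔ q ∈ deleted k l p cW cB := by
      intro q
      rw [mem_deleted]
      exact exists_congr fun i => or_comm
    rw [hc] at h ⊢
    refine A.free_right hm hn hM q ?_ h
    rw [mem_removedSet]
    rintro (⟨i, hi⟩ | ⟨i, hi⟩)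
    · exact h₂ i hi
    · exact h₁ i hi

end Local

theorem card_deleted (A : Arrangement (k + 1) l p cW cB) :
    (deleted k l p cW cB).card = s * (2 * ((k + 1) * (l + 1))) := by
  have hb := A.bounds
  have hc : ((deleted k l p cW cB : Finset (Cell m n p)) : Set (Cell m n p)) =
      {q | (∃ i, Deletes (k + 1) (l + 1) (cW i) q) ∨ ∃ i, Deletes (l + 1) (k + 1) (cB i) q} := by
    ext q
    rw [Finset.mem_coe, mem_deleted, exists_or]
    rfl
  rw [← Set.ncard_coe_finset, hc, ncard_or (x := (k + 1) * (l + 1)) (y := (l + 1) * (k + 1))]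
  · rw [Fintype.card_fin]; ring
  · exact fun q i j => A.deletes_inj_W q
  · exact fun q i j => A.deletes_inj_B q
  · exact fun q i j => A.not_deletes_both q
  · intro i
    have hp := A.parity_W i
    have := Cell.ncard_rectangle (p := p) (c := cW i) (N := k + 1) (M := l + 1)
      (by omega) (by omega) 0 0 (by rw [hp.1, map_zero]; linear_combination one_add_one)
      (by push_cast; rw [← hp.2, map_zero]; linear_combination one_add_one)
    simp only [add_zero] at this
    exact this
  · intro i
    have hp := A.parity_B i
    have := Cell.ncard_rectangle (p := p) (c := cB i) (N := l + 1) (M := k + 1)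
      (by omega) (by omega) 0 0
      (by push_cast; rw [← hp.1, map_zero]; linear_combination one_add_one)
      (by rw [hp.2, map_zero]; linear_combination one_add_one)
    simp only [add_zero] at this
    exact this

/-! ### Complementing all cells outside the deleted ones. -/

section Step

variable (A : Arrangement (k + 1) l p cW cB) (hm : 2 ≤ m) (hn : 2 ≤ n)
  (hM : numMatchings m n (removedSet (k + 1) l cW cB) ≠ 0)
include A hm hn hM

theorem present_add_lower (q : Cell m n p) :
    (present p (removedSet (k + 1) l cW cB)).1 q + (present p (removedSet k (l + 1) cW cB)).1 q =
      free (deleted k l p cW cB) q (down q) := by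
  have := (A.local_lower hm hn hM q).count
  simp only [present, free]
  convert this using 3
  · exact mem_removedSet
  · exact mem_removedSet
  · exact mem_deleted
  · exact mem_deleted

theorem present_add_right (q : Cell m n p) :
    (present p (removedSet (k + 1) l cW cB)).2 q + (present p (removedSet k (l + 1) cW cB)).2 q =
      free (deleted k l p cW cB) q (right q) := by
  have := (A.local_right hm hn hM q).count
  simp only [present, free]
  convert this using 3
  · exact mem_removedSet.trans or_comm
  · exact mem_removedSet.trans or_comm
  · exact mem_deleted.trans (exists_congr fun i => or_comm)
  · exact mem_deleted.trans (exists_congr fun i => or_comm)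

/-- If `l + 1 = m`, the cells deleted by a black window fill a whole cycle of rows. The vertex where
the cycle closes up lies between two deleted cells of one window but outside its inner grid, which
`eq_of_up_of_down` rules out. -/
theorem lt_left [NeZero s] : l + 1 < m := by
  by_contra hlm
  have hl := A.bounds.2.2.1
  obtain rfl : m = l + 1 := by omega
  obtain ⟨b, h1, h2, h3⟩ := exists_sub_add_mem_not_mem (NeZero.pos (l + 1)) (cB 0).1
  have h4 : (cB 0).2 - k ∈ arithSegment n (cB 0).2 (k + 1) := ⟨0, by omega, by push_cast; ring⟩
  have hp := A.parity_B 0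
  let q : Cell (l + 1) n p := ⟨(b - 1, (cB 0).2 - k), by
    rw [parity_of_mem_segment h1]
    push_cast
    rw [← hp.1]
    linear_combination one_add_one, by
    rw [parity_of_mem_segment h4, hp.2]
    linear_combination one_add_one⟩
  have hu : Deletes (l + 1) (k + 1) (cB 0) q := ⟨h1, h4⟩
  have hd : Deletes (l + 1) (k + 1) (cB 0) (down q) :=
    ⟨by rw [down_fst]; simpa [q] using h2, h4⟩
  have h5 := ((A.local_lower hm hn hM q).eq_of_up_of_down hu hd).2
  rw [A.lower_mem_B] at h5
  exact h3 (by simpa [q] using h5.1)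

theorem lt_right [NeZero s] : l + 1 < n := by
  by_contra hln
  have hl := A.bounds.2.2.2
  obtain rfl : n = l + 1 := by omega
  obtain ⟨b, h1, h2, h3⟩ := exists_sub_add_mem_not_mem (NeZero.pos (l + 1)) (cW 0).2
  have h4 : (cW 0).1 - k ∈ arithSegment m (cW 0).1 (k + 1) := ⟨0, by omega, by push_cast; ring⟩
  have hp := A.parity_W 0
  let q : Cell m (l + 1) p := ⟨((cW 0).1 - k, b - 1), by
    rw [parity_of_mem_segment h4, hp.1]
    linear_combination one_add_one, by
    rw [parity_of_mem_segment h1]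
    push_cast
    rw [← hp.2]
    linear_combination one_add_one⟩
  have hu : Deletes (k + 1) (l + 1) (cW 0) q := ⟨h4, h1⟩
  have hd : Deletes (k + 1) (l + 1) (cW 0) (right q) :=
    ⟨h4, by rw [right_snd]; simpa [q] using h2⟩
  have h5 := ((A.local_right hm hn hM q).eq_of_up_of_down hu hd).2
  rw [A.right_mem_W] at h5
  exact h3 (by simpa [q] using h5.2)

/-- The complementary windows again form an arrangement. -/
theorem compl [NeZero s] : Arrangement k (l + 1) (p + 1) cW cB := by
  have hpW : ∀ i, parity m (cW i).1 + k = p + 1 + 1 ∧ parity n (cW i).2 + (l + 1 : ℕ) = p + 1 := by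
    intro i
    refine ⟨?_, ?_⟩
    · rw [A.parity_W_compl i]
      linear_combination -one_add_one
    · push_cast
      rw [← (A.parity_W i).2]
      ring
  have hWB : ∀ v i j, v ∈ placedAztec m n k (l + 1) (cW i) →
      v ∉ placedAztec m n (l + 1) k (cB j) := by
    intro v i j
    rcases parity_eq_or p (parity m v.1.1) with h | h
    · obtain ⟨q, rfl⟩ := exists_of_parity v h
      exact (A.local_lower hm hn hM q).not_both_compl i j
    · obtain ⟨q, rfl⟩ := exists_of_parity' v h
      intro hi hj
      exact (A.local_right hm hn hM q).not_both_compl j i hj hi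
  have hb := A.bounds
  refine ⟨hpW, fun i => ⟨A.parity_B_compl i, ?_⟩,
    ⟨by omega, by omega, A.lt_left hm hn hM, A.lt_right hm hn hM⟩, ?_, ?_, hWB, ?_⟩
  · have := (A.parity_B i).2
    push_cast at this
    linear_combination this - one_add_one
  · intro v i j
    rcases parity_eq_or p (parity m v.1.1) with h | h
    · obtain ⟨q, rfl⟩ := exists_of_parity v h
      exact (A.local_lower hm hn hM q).inj_compl i j
    · obtain ⟨q, rfl⟩ := exists_of_parity' v h
      exact (A.local_right hm hn hM q).inj_compl' i j
  · intro v i j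
    rcases parity_eq_or p (parity m v.1.1) with h | h
    · obtain ⟨q, rfl⟩ := exists_of_parity v h
      exact (A.local_lower hm hn hM q).inj_compl' i j
    · obtain ⟨q, rfl⟩ := exists_of_parity' v h
      exact (A.local_right hm hn hM q).inj_compl i j
  -- The new second parameter `l + 1` is positive, so non-crossing is automatic after one step.
  · intro i j
    exact noncrossing_of_disjoint (NeZero.pos m) (NeZero.pos n) (Nat.succ_pos l) (hpW i)
      fun v => hWB v i j

theorem ncard_lower_compl [NeZero s] :
    {q : Cell m n p | vertV q true ∈ removedSet k (l + 1) cW cB}.ncard =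
      s * (k * (l + 1) + (l + 2) * (k + 1)) := by
  have hb := A.bounds
  have hb' := (A.compl hm hn hM).bounds
  simp only [mem_removedSet]
  rw [ncard_or (x := k * (l + 1)) (y := (l + 2) * (k + 1)), Fintype.card_fin]
  · exact fun q i j => (A.local_lower hm hn hM q).inj_compl i j
  · exact fun q i j => (A.local_lower hm hn hM q).inj_compl' i j
  · exact fun q i j => (A.local_lower hm hn hM q).not_both_compl i j
  · intro i
    have hp := A.parity_W i
    have := Cell.ncard_rectangle (p := p) (c := cW i) (N := k) (M := l + 1)
      (by omega) (by omega) 1 0 (by rw [A.parity_W_compl, map_one])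
      (by push_cast; rw [← hp.2, map_zero]; linear_combination one_add_one)
    simp only [A.lower_mem_W_compl]
    simpa only [add_zero] using this
  · intro i
    have hp := A.parity_B i
    have := Cell.ncard_rectangle (p := p) (c := cB i) (N := l + 2) (M := k + 1)
      (by omega) (by omega) 1 0
      (by push_cast; rw [← hp.1, map_one]; linear_combination one_add_one)
      (by rw [hp.2, map_zero]; linear_combination one_add_one)
    simp only [A.lower_mem_B_compl]
    simpa only [add_zero] using this

theorem ncard_right_compl [NeZero s] :
    {q : Cell m n p | vertH q true ∈ removedSet k (l + 1) cW cB}.ncard =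
      s * (k * (l + 1) + (l + 2) * (k + 1)) := by
  have hb := A.bounds
  have hb' := (A.compl hm hn hM).bounds
  simp only [mem_removedSet]
  rw [ncard_or (x := (k + 1) * (l + 2)) (y := (l + 1) * k), Fintype.card_fin]
  · ring
  · exact fun q i j => (A.local_right hm hn hM q).inj_compl' i j
  · exact fun q i j => (A.local_right hm hn hM q).inj_compl i j
  · exact fun q i j hi hj => (A.local_right hm hn hM q).not_both_compl j i hj hi
  · intro i
    have hp := A.parity_W i
    have := Cell.ncard_rectangle (p := p) (c := cW i) (N := k + 1) (M := l + 2)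
      (by omega) (by omega) 0 1 (by rw [hp.1, map_zero]; linear_combination one_add_one)
      (by push_cast; rw [← hp.2, map_one]; linear_combination one_add_one)
    simp only [A.right_mem_W_compl]
    simpa only [add_zero] using this
  · intro i
    have hp := A.parity_B i
    have := Cell.ncard_rectangle (p := p) (c := cB i) (N := l + 1) (M := k)
      (by omega) (by omega) 0 1
      (by push_cast; rw [← hp.1, map_zero]; linear_combination one_add_one)
      (by rw [map_one]; have := hp.2; push_cast at this; linear_combination this)
    simp only [A.right_mem_B_compl]
    simpa only [add_zero] using this

theorem sum_present_compl [NeZero s] :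
    (∑ q : Cell m n p, ((present p (removedSet k (l + 1) cW cB)).1 q +
      (present p (removedSet k (l + 1) cW cB)).2 q)) +
      2 * (s * (k * (l + 1) + (l + 2) * (k + 1))) = 2 * Fintype.card (Cell m n p) := by
  classical
  have key : ∀ P : Cell m n p → Prop, (∑ q, if P q then 0 else 1) + {q | P q}.ncard =
      Fintype.card (Cell m n p) := by
    intro P
    have h1 : {q | P q}.ncard = ∑ q, if P q then 1 else 0 := by
      rw [← Finset.card_filter, ← Set.ncard_coe_finset]
      congr 1
      ext q
      simp
    rw [h1, ← Finset.sum_add_distrib, ← Finset.card_univ, Finset.card_eq_sum_ones]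
    refine Finset.sum_congr rfl fun q _ => ?_
    split_ifs <;> rfl
  have h1 := key fun q => vertV q true ∈ removedSet k (l + 1) cW cB
  have h2 := key fun q => vertH q true ∈ removedSet k (l + 1) cW cB
  rw [A.ncard_lower_compl hm hn hM] at h1
  rw [A.ncard_right_compl hm hn hM] at h2
  rw [Finset.sum_add_distrib]
  have e1 : (∑ q : Cell m n p, if vertV q true ∈ removedSet k (l + 1) cW cB then 0 else 1) =
    ∑ q : Cell m n p, (present p (removedSet k (l + 1) cW cB)).1 q :=
      Finset.sum_congr rfl fun q _ => by simp only [present]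
  have e2 : (∑ q : Cell m n p, if vertH q true ∈ removedSet k (l + 1) cW cB then 0 else 1) =
    ∑ q : Cell m n p, (present p (removedSet k (l + 1) cW cB)).2 q :=
      Finset.sum_congr rfl fun q _ => by simp only [present]
  rw [e1] at h1
  rw [e2] at h2
  omega

/-- One complementation step turns windows of shape `O_{k+1,l}` into windows of shape
`O_{k,l+1}`. -/
theorem numMatchings_compl [NeZero s] :
    numMatchings m n (removedSet (k + 1) l cW cB) * 2 ^ (s * (2 * ((k + 1) * (l + 1)))) =
      2 ^ (s * (k * (l + 1) + (l + 2) * (k + 1))) *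
        numMatchings m n (removedSet k (l + 1) cW cB) := by
  have hle : ∀ S : Set (TorusVertex m n), (∀ q, (present p S).1 q ≤ 1) ∧
      ∀ q, (present p S).2 q ≤ 1 := by
    intro S
    simp only [present]
    exact ⟨fun q => by split_ifs <;> omega, fun q => by split_ifs <;> omega⟩
  have h := card_configs_mul (D := deleted k l p cW cB) (hle (removedSet (k + 1) l cW cB)).1
    (hle (removedSet (k + 1) l cW cB)).2 (hle (removedSet k (l + 1) cW cB)).1
    (hle (removedSet k (l + 1) cW cB)).2 (fun e he q hq => A.config_deleted he hq)
    (fun e he q hq => A.config_deleted_compl he hq) (A.present_add_lower hm hn hM)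
    (A.present_add_right hm hn hM)
  rw [← numMatchings_eq hm hn, ← numMatchings_eq hm hn, A.card_deleted] at h
  have h2 : ∀ j : ℕ, (2 : ℝ) ^ j = √2 ^ (2 * j) := fun j => by
    rw [pow_mul, Real.sq_sqrt (by norm_num)]
  have hs := A.sum_present_compl hm hn hM
  set T := s * (k * (l + 1) + (l + 2) * (k + 1))
  -- There are `2 * Fintype.card (Cell m n p)` vertices, of which the new windows remove `2 * T`.
  -- Multiplying by `2 ^ T` therefore completes the power of `√2` to `2 ^ Fintype.card (Cell m n
  -- p)`, which cancels.
  have h3 := congrArg (fun x : ℝ => x * 2 ^ T) h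
  have h4 : √2 ^ (∑ q : Cell m n p, ((present p (removedSet k (l + 1) cW cB)).1 q +
      (present p (removedSet k (l + 1) cW cB)).2 q)) * (2 : ℝ) ^ T =
      2 ^ Fintype.card (Cell m n p) := by
    rw [h2 T, h2 (Fintype.card _), ← pow_add, hs]
  have h5 : (2 : ℝ) ^ Fintype.card (Cell m n p) ≠ 0 := by positivity
  have h6 : (numMatchings m n (removedSet (k + 1) l cW cB) : ℝ) *
      2 ^ (s * (2 * ((k + 1) * (l + 1)))) =
      2 ^ T * numMatchings m n (removedSet k (l + 1) cW cB) := by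
    apply mul_left_cancel₀ h5
    linear_combination h3 - (numMatchings m n (removedSet (k + 1) l cW cB) : ℝ) *
      2 ^ (s * (2 * ((k + 1) * (l + 1)))) * h4
  exact_mod_cast h6

end Step

end Arrangement

/-! ## Point reflections -/

theorem SimpleGraph.Subgraph.IsPerfectMatching.map_iso {V V' : Type*} {G : SimpleGraph V}
    {G' : SimpleGraph V'} (e : G ≃g G') {M : G.Subgraph} (hM : M.IsPerfectMatching) :
    (M.map e.toHom).IsPerfectMatching := by
  rw [SimpleGraph.Subgraph.isPerfectMatching_iff] at hM ⊢
  intro v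
  obtain ⟨w, hw, hu⟩ := hM (e.symm v)
  refine ⟨e w, ⟨e.symm v, w, hw, e.apply_symm_apply v, rfl⟩, ?_⟩
  rintro w' ⟨a, b, hab, rfl, rfl⟩
  refine congrArg e (hu b ?_)
  have : e.symm (e a) = a := e.symm_apply_apply a
  exact this.symm ▸ hab

theorem SimpleGraph.Iso.ncard_perfectMatchings_le {V V' : Type*} [Finite V'] {G : SimpleGraph V}
    {G' : SimpleGraph V'} (e : G ≃g G') :
    {M : G.Subgraph | M.IsPerfectMatching}.ncard ≤
      {M : G'.Subgraph | M.IsPerfectMatching}.ncard := by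
  refine Set.ncard_le_ncard_of_injOn (fun M => M.map e.toHom)
    (fun M hM => SimpleGraph.Subgraph.IsPerfectMatching.map_iso e hM) ?_ (Set.toFinite _)
  have hinj : Function.LeftInverse (fun M : G'.Subgraph => M.map e.symm.toHom)
      (fun M : G.Subgraph => M.map e.toHom) := by
    intro M
    simp only
    rw [← SimpleGraph.Subgraph.map_comp]
    have : e.symm.toHom.comp e.toHom = SimpleGraph.Hom.id := by
      ext v
      exact e.symm_apply_apply v
    rw [this, SimpleGraph.Subgraph.map_id]
  exact hinj.injective.injOn

theorem SimpleGraph.Iso.ncard_perfectMatchings_eq {V V' : Type*} [Finite V] [Finite V']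
    {G : SimpleGraph V} {G' : SimpleGraph V'} (e : G ≃g G') :
    {M : G.Subgraph | M.IsPerfectMatching}.ncard =
      {M : G'.Subgraph | M.IsPerfectMatching}.ncard :=
  le_antisymm e.ncard_perfectMatchings_le e.symm.ncard_perfectMatchings_le

section Reflection

variable {m n : ℕ}

/-- The point reflection exchanging the positions `c` and `c'`. -/
def pointReflection [NeZero m] [NeZero n] {c c' : TorusPos m n}
    (h : parity m (c.1 + c'.1) + parity n (c.2 + c'.2) = 0) : torusGraph m n ≃g torusGraph m n where
  toFun v := ⟨(c.1 + c'.1 - v.1.1, c.2 + c'.2 - v.1.2), by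
    have hv := (Cell.odd_iff _ _).mp v.2
    rw [Cell.odd_iff, map_sub, map_sub]
    linear_combination h - hv - Arrangement.one_add_one⟩
  invFun v := ⟨(c.1 + c'.1 - v.1.1, c.2 + c'.2 - v.1.2), by
    have hv := (Cell.odd_iff _ _).mp v.2
    rw [Cell.odd_iff, map_sub, map_sub]
    linear_combination h - hv - Arrangement.one_add_one⟩
  left_inv v := by simp
  right_inv v := by simp
  map_rel_iff' := by
    intro u v
    have key : ∀ {t : ℕ} (x a b : ZMod (2 * t)), x - a = x - b + 1 ↔ b = a + 1 := by
      intro t x a b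
      constructor <;> intro h
      · linear_combination h
      · linear_combination h
    simp only [torusGraph, Equiv.coe_fn_mk, key]
    exact and_congr or_comm or_comm

theorem reflect_mem_arithSegment_iff {N : ℕ} {a c c' : ZMod (2 * m)} :
    c + c' - a ∈ arithSegment m c' N ↔ a ∈ arithSegment m c N := by
  constructor
  · rintro ⟨x, hx, h⟩
    -- The reflection reverses the order of the segment.
    refine ⟨N - 1 - x, by omega, ?_⟩
    have : ((N - 1 - x : ℕ) : ZMod (2 * m)) = N - 1 - x := by
      rw [Nat.cast_sub (by omega), Nat.cast_sub (by omega), Nat.cast_one]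
    rw [this]
    linear_combination -h
  · rintro ⟨x, hx, h⟩
    refine ⟨N - 1 - x, by omega, ?_⟩
    have : ((N - 1 - x : ℕ) : ZMod (2 * m)) = N - 1 - x := by
      rw [Nat.cast_sub (by omega), Nat.cast_sub (by omega), Nat.cast_one]
    rw [this]
    linear_combination -h

variable [NeZero m] [NeZero n] {c c' : TorusPos m n}
  (h : parity m (c.1 + c'.1) + parity n (c.2 + c'.2) = 0)

theorem pointReflection_mem_iff {k l : ℕ} {v : TorusVertex m n} :
    pointReflection h v ∈ placedAztec m n k l c' ↔ v ∈ placedAztec m n k l c := by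
  have h1 : (pointReflection h v).1.1 = c.1 + c'.1 - v.1.1 := rfl
  have h2 : (pointReflection h v).1.2 = c.2 + c'.2 - v.1.2 := rfl
  simp only [mem_placedAztec_iff, h1, h2, reflect_mem_arithSegment_iff]

theorem pointReflection_mem_iff' {k l : ℕ} {v : TorusVertex m n} :
    pointReflection h v ∈ placedAztec m n k l c ↔ v ∈ placedAztec m n k l c' := by
  have h1 : (pointReflection h v).1.1 = c'.1 + c.1 - v.1.1 := by rw [add_comm c'.1]; rfl
  have h2 : (pointReflection h v).1.2 = c'.2 + c.2 - v.1.2 := by rw [add_comm c'.2]; rfl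
  simp only [mem_placedAztec_iff, h1, h2, reflect_mem_arithSegment_iff]

include h in
theorem numMatchings_reflection {k l k' l' : ℕ} {S S' : Set (TorusVertex m n)}
    (hS : S = placedAztec m n k l c ∪ placedAztec m n k' l' c')
    (hS' : S' = placedAztec m n k' l' c ∪ placedAztec m n k l c') :
    numMatchings m n S = numMatchings m n S' := by
  have hmem : ∀ v, v ∈ S' ↔ (pointReflection h).symm v ∈ S := by
    intro v
    have hv : pointReflection h ((pointReflection h).symm v) = v :=
      (pointReflection h).apply_symm_apply v
    rw [hS, hS', Set.mem_union, Set.mem_union,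
      ← pointReflection_mem_iff h (v := (pointReflection h).symm v),
      ← pointReflection_mem_iff' h (v := (pointReflection h).symm v), hv]
    exact or_comm
  let e : (torusGraph m n).induce Sᶜ ≃g (torusGraph m n).induce S'ᶜ :=
    { toEquiv := (pointReflection h).toEquiv.subtypeEquiv (fun v => by
        rw [Set.mem_compl_iff, Set.mem_compl_iff, hmem]
        have : (pointReflection h).symm ((pointReflection h).toEquiv v) = v :=
          (pointReflection h).symm_apply_apply v
        rw [this])
      map_rel_iff' := (pointReflection h).map_rel_iff' }
  exact e.ncard_perfectMatchings_eq

end Reflection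

/-! ## Colourings of the toroidal Aztec rectangle -/

/-- Adjacent vertices lie in rows of opposite parity and the graph is connected, so the row parity
is the only proper 2-colouring up to swapping the colours. -/
theorem exists_parity_of_coloring {m n : ℕ} [NeZero m] [NeZero n]
    (c : (torusGraph m n).Coloring Bool) :
    ∃ P : ZMod 2, ∀ v, c v = true ↔ parity m v.1.1 = P := by
  have hodd : ∀ x y : ℕ, Odd (((1 + 2 * x : ZMod (2 * m))).val + ((2 * y : ZMod (2 * n))).val) := by
    intro x y
    rw [Cell.odd_iff]
    simp [Cell.parity_two]
  have hodd' : ∀ x y : ℕ, Odd (((2 + 2 * x : ZMod (2 * m))).val +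
      ((2 * y + 1 : ZMod (2 * n))).val) := by
    intro x y
    rw [Cell.odd_iff]
    simp [Cell.parity_two]
  have hne : ∀ u v, (torusGraph m n).Adj u v → c v = !c u := by
    intro u v h
    have := c.valid h
    cases hu : c u <;> cases hv : c v <;> simp_all
  -- The vertices `f x y` exhaust the odd rows, and `g x y` is a common neighbour of `f x y`, `f (x
  -- + 1) y` and `f x (y + 1)`.
  let f : ℕ → ℕ → TorusVertex m n := fun x y => ⟨(1 + 2 * x, 2 * y), hodd x y⟩
  let g : ℕ → ℕ → TorusVertex m n := fun x y => ⟨(2 + 2 * x, 2 * y + 1), hodd' x y⟩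
  have hfg : ∀ x y, c (g x y) = !c (f x y) := fun x y =>
    hne _ _ ⟨Or.inl (by simp only [f, g]; ring), Or.inl (by simp only [f, g])⟩
  have hfg1 : ∀ x y, c (f (x + 1) y) = c (f x y) := by
    intro x y
    have := hne (g x y) (f (x + 1) y)
      ⟨Or.inl (by simp only [f, g]; push_cast; ring), Or.inr (by simp only [f, g])⟩
    rw [this, hfg, Bool.not_not]
  have hfg2 : ∀ x y, c (f x (y + 1)) = c (f x y) := by
    intro x y
    have := hne (g x y) (f x (y + 1))
      ⟨Or.inr (by simp only [f, g]; ring), Or.inl (by simp only [f, g]; push_cast; ring)⟩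
    rw [this, hfg, Bool.not_not]
  have hf : ∀ x y, c (f x y) = c (f 0 0) := by
    intro x y
    induction x with
    | zero =>
      induction y with
      | zero => rfl
      | succ y ih => rw [hfg2, ih]
    | succ x ih => rw [hfg1, ih]
  have hsurj : ∀ v : TorusVertex m n, parity m v.1.1 = 1 → ∃ x y, v = f x y := by
    have heven : ∀ {t : ℕ} [NeZero t] (a : ZMod (2 * t)), parity t a = 0 →
        ∃ x : ℕ, a = 2 * (x : ZMod (2 * t)) := by
      intro t _ a ha
      have hn := NeZero.ne (2 * t)
      have h1 : ((a.val : ℕ) : ZMod 2) = 0 := by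
        rw [← ha]
        conv_rhs => rw [← ZMod.natCast_zmod_val a]
        exact (map_natCast (parity t) _).symm
      obtain ⟨x, hx⟩ := even_iff_two_dvd.mp ((ZMod.natCast_eq_zero_iff_even).mp h1)
      refine ⟨x, ?_⟩
      conv_lhs => rw [← ZMod.natCast_zmod_val a, hx]
      push_cast
      rfl
    intro v hv
    have hv' := (Cell.odd_iff _ _).mp v.2
    obtain ⟨x, hx⟩ := heven (v.1.1 - 1) (by rw [map_sub, hv, map_one, sub_self])
    obtain ⟨y, hy⟩ := heven v.1.2 (by rw [hv] at hv'; linear_combination hv')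
    refine ⟨x, y, Subtype.ext (Prod.ext ?_ hy)⟩
    simp only [f]
    linear_combination hx
  have h1 : ∀ v : TorusVertex m n, parity m v.1.1 = 1 → c v = c (f 0 0) := by
    intro v hv
    obtain ⟨x, y, rfl⟩ := hsurj v hv
    exact hf x y
  have h0 : ∀ v : TorusVertex m n, parity m v.1.1 = 0 → c v = !c (f 0 0) := by
    intro v hv
    have hv' := (Cell.odd_iff _ _).mp v.2
    let w : TorusVertex m n := ⟨(v.1.1 + 1, v.1.2 + 1), by
      rw [Cell.odd_iff, map_add, map_add, map_one, map_one]
      linear_combination hv' + Arrangement.one_add_one⟩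
    rw [← h1 w (by simp [w, hv])]
    exact hne w v ⟨Or.inr rfl, Or.inr rfl⟩
  have hz : ∀ x : ZMod 2, x = 0 ∨ x = 1 := by decide
  have h01 : (0 : ZMod 2) ≠ 1 := by decide
  cases hc : c (f 0 0)
  · refine ⟨0, fun v => ?_⟩
    rcases hz (parity m v.1.1) with h | h
    · simp [h, h0 v h, hc]
    · simp [h, h1 v h, hc]
  · refine ⟨1, fun v => ?_⟩
    rcases hz (parity m v.1.1) with h | h
    · simp [h, h0 v h, hc]
    · simp [h, h1 v h, hc]

/-- A diagonal shift embeds the inner grid into the corner grid. Hence a strict majority colour can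
only be that of the corners. -/
theorem ncard_inner_le_ncard_corner {m n k l : ℕ} [NeZero m] [NeZero n] {C : TorusPos m n}
    {P Q : ZMod 2} (hP : parity m C.1 + k = P) (hQ : Q ≠ P) :
    {v ∈ placedAztec m n k l C | parity m v.1.1 = Q}.ncard ≤
      {v ∈ placedAztec m n k l C | parity m v.1.1 = P}.ncard := by
  have hQ' : Q = P + 1 := (Cell.parity_eq_or P Q).resolve_right hQ
  refine Set.ncard_le_ncard_of_injOn (fun v => ⟨(v.1.1 - 1, v.1.2 - 1), by
    have hv' := (Cell.odd_iff _ _).mp v.2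
    rw [Cell.odd_iff, map_sub, map_sub, map_one, map_one]
    linear_combination hv' - Arrangement.one_add_one⟩) ?_ ?_ (Set.toFinite _)
  · rintro v ⟨hv, hp⟩
    rw [mem_placedAztec_iff_inner (by rw [hp, hP]; exact hQ)] at hv
    refine ⟨mem_placedAztec_iff.mpr (Or.inl
      ⟨sub_one_mem_segment hv.1, sub_one_mem_segment hv.2⟩), ?_⟩
    simp only [map_sub, map_one, hp, hQ']
    ring
  · intro v _ w _ h
    simp only [Subtype.mk.injEq, Prod.mk.injEq, sub_left_inj] at h
    exact Subtype.ext (Prod.ext h.1 h.2)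

namespace OddWindow

variable {m n k l : ℕ} (O : OddWindow m n k l)
include O

/-- On a board with `k ≥ m` the squares in rows `0` and `2 * m` of the first column would land on
the same position. -/
theorem lt_rows (hm : 0 < m) : k < m := by
  by_contra hk
  obtain ⟨φ, hφ⟩ := O.isCopy
  let p : OddAztecVertex k l := ⟨(⟨0, by omega⟩, ⟨0, by omega⟩), by simp⟩
  let q : OddAztecVertex k l := ⟨(⟨2 * m, by omega⟩, ⟨0, by omega⟩), by simp⟩
  have h : φ p = φ q := by
    apply Subtype.ext
    rw [hφ, hφ]
    simp only [boardPos, p, q]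
    rw [ZMod.natCast_self, Nat.cast_zero]
  have := congrArg (fun x : OddAztecVertex k l => x.1.1.val) (φ.injective h)
  simp only [p, q] at this
  omega

theorem lt_columns (hn : 0 < n) : l < n := by
  by_contra hl
  obtain ⟨φ, hφ⟩ := O.isCopy
  let p : OddAztecVertex k l := ⟨(⟨0, by omega⟩, ⟨0, by omega⟩), by simp⟩
  let q : OddAztecVertex k l := ⟨(⟨0, by omega⟩, ⟨2 * n, by omega⟩), by simp⟩
  have h : φ p = φ q := by
    apply Subtype.ext
    rw [hφ, hφ]
    simp only [boardPos, p, q]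
    rw [ZMod.natCast_self, Nat.cast_zero, Nat.cast_zero]
  have := congrArg (fun x : OddAztecVertex k l => x.1.2.val) (φ.injective h)
  simp only [p, q] at this
  omega

theorem parity_center [NeZero m] [NeZero n] :
    parity m O.center.1 + k + (parity n O.center.2 + l) = 1 := by
  obtain ⟨φ, hφ⟩ := O.isCopy
  let p : OddAztecVertex k l := ⟨(⟨0, by omega⟩, ⟨0, by omega⟩), by simp⟩
  have h := (Cell.odd_iff _ _).mp (φ p).2
  rw [hφ] at h
  simp only [boardPos, p, Nat.cast_zero, add_zero, map_sub, map_natCast] at h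
  linear_combination h + CharTwo.add_self_eq_zero (k : ZMod 2) +
    CharTwo.add_self_eq_zero (l : ZMod 2)

theorem parity_of_isWhitePlaced [NeZero m] [NeZero n] {c : (torusGraph m n).Coloring Bool}
    {P : ZMod 2} (hP : ∀ v, c v = true ↔ parity m v.1.1 = P) (h : IsWhitePlaced c O.verts) :
    parity m O.center.1 + k = P := by
  by_contra hne
  refine absurd h (not_lt.mpr ?_)
  have hset : ∀ v, c v = false ↔ parity m v.1.1 = parity m O.center.1 + k := by
    intro v
    rw [← Bool.not_eq_true, hP]
    have key : ∀ x y P : ZMod 2, y ≠ P → (¬ x = P ↔ x = y) := by decide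
    exact key _ _ _ hne
  simp only [hset, hP]
  exact ncard_inner_le_ncard_corner rfl (Ne.symm hne)

theorem parity_of_isBlackPlaced [NeZero m] [NeZero n] {c : (torusGraph m n).Coloring Bool}
    {P : ZMod 2} (hP : ∀ v, c v = true ↔ parity m v.1.1 = P) (h : IsBlackPlaced c O.verts) :
    parity m O.center.1 + k = P + 1 := by
  by_contra hne
  have hPc := (Cell.parity_eq_or P (parity m O.center.1 + k)).resolve_left hne
  refine absurd h (not_lt.mpr ?_)
  have hset : ∀ v, c v = false ↔ parity m v.1.1 = P + 1 := by
    intro v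
    rw [← Bool.not_eq_true, hP]
    have key : ∀ x P : ZMod 2, ¬ x = P ↔ x = P + 1 := by decide
    exact key _ _
  simp only [hset, hP]
  exact ncard_inner_le_ncard_corner hPc (by simp)

end OddWindow

/-! ## The theorem -/

/-- The windows of an arrangement can be replaced by slits with the same centres. -/
theorem Arrangement.numMatchings_slits {m n s : ℕ} [NeZero s] {cW cB : Fin s → TorusPos m n}
    (k l : ℕ) (p : ZMod 2) (A : Arrangement k l p cW cB)
    (hM : numMatchings m n (removedSet k l cW cB) ≠ 0) :
    numMatchings m n (removedSet k l cW cB) * 2 ^ (s * k * l) =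
      numMatchings m n (removedSet 0 (k + l) cW cB) := by
  induction k generalizing l p with
  | zero => simp
  | succ k ih =>
    have hb := A.bounds
    have : NeZero m := ⟨by omega⟩
    have : NeZero n := ⟨by omega⟩
    have hm : 2 ≤ m := by omega
    have hn : 2 ≤ n := by omega
    have h1 := A.numMatchings_compl hm hn hM
    -- Each step needs a matching to exist; this is inherited because the two counts differ by
    -- nonzero factors.
    have hM' : numMatchings m n (removedSet k (l + 1) cW cB) ≠ 0 := by
      intro h0
      rw [h0, mul_zero] at h1
      exact hM ((mul_eq_zero.mp h1).resolve_right (by positivity))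
    have h2 := ih (l + 1) (p + 1) (A.compl hm hn hM) hM'
    rw [show k + 1 + l = k + (l + 1) by ring, ← h2]
    have h3 : 0 < 2 ^ (s * (k * (l + 1) + (l + 2) * (k + 1))) := by positivity
    apply Nat.eq_of_mul_eq_mul_left h3
    have e : s * (k * (l + 1) + (l + 2) * (k + 1)) + s * (k + 1) * l =
        s * (2 * ((k + 1) * (l + 1))) + s * k * (l + 1) := by ring
    rw [mul_left_comm, ← pow_add, e, pow_add, ← mul_assoc, h1, mul_assoc]

theorem theorem4p4 (m n k l s : ℕ) (hm : 0 < m) (hn : 0 < n)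
    (c : (torusGraph m n).Coloring Bool)
    (W : Fin s → OddWindow m n k l) (B : Fin s → OddWindow m n l k)
    (hW : ∀ i, IsWhitePlaced c (W i).verts) (hB : ∀ i, IsBlackPlaced c (B i).verts)
    (hdisj : Pairwise (Function.onFun Disjoint
      (Sum.elim (fun i => (W i).verts) (fun i => (B i).verts))))
    (hcross : l = 0 → 2 ≤ s → ∀ i j, ¬ Crosses (W i).verts (B j).verts)
    (hmatch : ∃ M : ((torusGraph m n).induce
      ((⋃ i, (W i).verts) ∪ (⋃ i, (B i).verts))ᶜ).Subgraph, M.IsPerfectMatching) :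
    (numMatchings m n ((⋃ i, (W i).verts) ∪ (⋃ i, (B i).verts)) : ℚ) =
      (2 : ℚ) ^ (-((s * k * l : ℕ) : ℤ)) *
        (numMatchings m n ((⋃ i, (W i).hSlit) ∪ (⋃ i, (B i).vSlit)) : ℚ) := by
  have : NeZero m := ⟨hm.ne'⟩
  have : NeZero n := ⟨hn.ne'⟩
  have h2m : NeZero (2 * m) := ⟨by omega⟩
  have h2n : NeZero (2 * n) := ⟨by omega⟩
  rcases Nat.eq_zero_or_pos s with rfl | hs
  · simp
  have : NeZero s := ⟨hs.ne'⟩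
  obtain ⟨P, hP⟩ := exists_parity_of_coloring c
  have hpW : ∀ i, parity m (W i).center.1 + k = P ∧ parity n (W i).center.2 + l = P + 1 := by
    intro i
    have h1 := (W i).parity_of_isWhitePlaced hP (hW i)
    refine ⟨h1, ?_⟩
    have h2 := (W i).parity_center
    rw [h1] at h2
    linear_combination h2 - CharTwo.add_self_eq_zero P
  have hpB : ∀ i, parity m (B i).center.1 + l = P + 1 ∧ parity n (B i).center.2 + k = P := by
    intro i
    have h1 := (B i).parity_of_isBlackPlaced hP (hB i)
    refine ⟨h1, ?_⟩
    have h2 := (B i).parity_center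
    rw [h1] at h2
    linear_combination h2 - CharTwo.add_self_eq_zero P
  -- With one slit of each kind, crossing is allowed and complementation may not apply. The point
  -- reflection swapping the two centres maps a vertical slit at one and a horizontal slit at the
  -- other to the same slits with centres exchanged, as required.
  by_cases hdeg : l = 0 ∧ s = 1
  · obtain ⟨rfl, rfl⟩ := hdeg
    have hpar : parity m ((W 0).center.1 + (B 0).center.1) +
        parity n ((W 0).center.2 + (B 0).center.2) = 0 := by
      have h1 := (W 0).parity_center
      have h2 := (B 0).parity_center
      rw [map_add, map_add]
      linear_combination h1 + h2 - CharTwo.add_self_eq_zero (k : ZMod 2) +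
        Arrangement.one_add_one - 2 * CharTwo.add_self_eq_zero ((0 : ℕ) : ZMod 2)
    have hU : ∀ f : Fin 1 → Set (TorusVertex m n), ⋃ i, f i = f 0 := fun f => iSup_unique f
    have key : numMatchings m n ((⋃ i, (W i).verts) ∪ (⋃ i, (B i).verts)) =
        numMatchings m n ((⋃ i, (W i).hSlit) ∪ (⋃ i, (B i).vSlit)) := by
      refine numMatchings_reflection hpar (k := k) (l := 0) (k' := 0) (l' := k) ?_ ?_
      · rw [hU, hU]; rfl
      · rw [hU, hU]
        simp only [OddWindow.hSlit, OddWindow.vSlit, add_zero, zero_add]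
    rw [key]
    simp
  have hWB : ∀ v i j, v ∈ placedAztec m n k l (W i).center →
      v ∉ placedAztec m n l k (B j).center := by
    intro v i j hi hj
    have h := hdisj (show (Sum.inl i : Fin s ⊕ Fin s) ≠ Sum.inr j by simp)
    exact Set.disjoint_left.mp h hi hj
  have A : Arrangement k l (P + 1) (fun i => (W i).center) (fun i => (B i).center) := by
    have hpW' : ∀ i, parity m (W i).center.1 + k = P + 1 + 1 ∧
        parity n (W i).center.2 + l = P + 1 := fun i =>
      ⟨(hpW i).1.trans (by linear_combination -Arrangement.one_add_one), (hpW i).2⟩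
    refine ⟨hpW', fun i => ⟨(hpB i).1, (hpB i).2.trans
      (by linear_combination -Arrangement.one_add_one)⟩, ⟨(W 0).lt_rows hm, (B 0).lt_columns hn,
      (B 0).lt_rows hm, (W 0).lt_columns hn⟩, ?_, ?_, hWB, ?_⟩
    · intro v i j hi hj
      by_contra hij
      have h := hdisj (show (Sum.inl i : Fin s ⊕ Fin s) ≠ Sum.inl j by simpa using hij)
      exact Set.disjoint_left.mp h hi hj
    · intro v i j hi hj
      by_contra hij
      have h := hdisj (show (Sum.inr i : Fin s ⊕ Fin s) ≠ Sum.inr j by simpa using hij)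
      exact Set.disjoint_left.mp h hi hj
    · intro i j f h₁ h₂ h₃ h₄
      -- For `l = 0` a cell deleted by both colours is literally a crossing at `f`, and `s ≥ 2`
      -- since the case `s = 1` has been settled.
      rcases Nat.eq_zero_or_pos l with rfl | hl
      · refine hcross rfl (by omega) i j ⟨f, ?_⟩
        have h1 := parity_of_mem_segment h₁
        have h2 := parity_of_mem_segment h₂
        rw [(hpW i).1] at h1
        push_cast at h2
        have hp : parity m f.1 + parity n f.2 = 0 := by
          have h3 := (hpW i).2
          push_cast at h3
          rw [h1, h2]
          linear_combination h3 + CharTwo.add_self_eq_zero P + 2 * Arrangement.one_add_one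
        refine ⟨⟨⟨(f.1 - 1, f.2), ?_⟩, mem_placedAztec_iff.mpr
            (Or.inl ⟨sub_one_mem_segment h₁, h₂⟩), rfl⟩,
          ⟨⟨(f.1 + 1, f.2), ?_⟩, mem_placedAztec_iff.mpr
            (Or.inl ⟨add_one_mem_segment h₁, h₂⟩), rfl⟩,
          ⟨⟨(f.1, f.2 - 1), ?_⟩, mem_placedAztec_iff.mpr
            (Or.inl ⟨h₃, sub_one_mem_segment h₄⟩), rfl⟩,
          ⟨⟨(f.1, f.2 + 1), ?_⟩, mem_placedAztec_iff.mpr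
            (Or.inl ⟨h₃, add_one_mem_segment h₄⟩), rfl⟩⟩ <;>
          rw [Cell.odd_iff] <;> simp only [map_sub, map_add, map_one]
        · linear_combination hp - Arrangement.one_add_one
        · linear_combination hp
        · linear_combination hp - Arrangement.one_add_one
        · linear_combination hp
      · exact noncrossing_of_disjoint hm hn hl (hpW' i) (fun v => hWB v i j) f h₁ h₂ h₃ h₄
  have hM : numMatchings m n
      (removedSet k l (fun i => (W i).center) fun i => (B i).center) ≠ 0 := by
    obtain ⟨M, hM⟩ := hmatch
    exact Set.ncard_ne_zero_of_mem hM
  have key := A.numMatchings_slits k l (P + 1) hM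
  have e1 : removedSet k l (fun i => (W i).center) (fun i => (B i).center) =
      (⋃ i, (W i).verts) ∪ (⋃ i, (B i).verts) := rfl
  have e2 : removedSet 0 (k + l) (fun i => (W i).center) (fun i => (B i).center) =
      (⋃ i, (W i).hSlit) ∪ (⋃ i, (B i).vSlit) := by
    simp only [removedSet, OddWindow.hSlit, OddWindow.vSlit, add_comm l k]
  rw [e1, e2] at key
  rw [← key, zpow_neg, zpow_natCast]
  push_cast
  field_simp
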